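/- **Convergence of the involutes iteration.** Let $\mathcal P$ be a normed plane ($\mathbb R^2$ with a norm) whose unit circle is smooth and quadratically convex, and let $p(\theta)$, $p(\theta+\pi)=-p(\theta)$, be the smooth parametrization of the unit circle by the angle $\theta$ of its tangent with a fixed direction, with $p'(\theta)$ a positive multiple of the unit vector at angle $\theta$ from that direction. Let $[\cdot,\cdot]$ be the determinant and $q=p'/[p,p']$ the dual parametrization. On $C^0(S^1)$ (continuous $2\pi$-periodic functions) use $\langle h_1,h_2\rangle=\int_0^{2\pi}h_1h_2[p,p']\,d\theta$, let $L_0$ be the orthogonal complement of the constants, and put $$Th=-\frac1{[p,p']}\Big(\frac{h'}{[q,q']}\Big)'.$$ A $2\pi$-periodic eigenfunction $u\ne0$ of $T$ has *index* $k$ if it has exactly $2k$ zeros in a period. Let $C_0\subset L_0$ be the closure, in the norm of $\langle\cdot,\cdot\rangle$ and within $L_0$, of the span of the eigenfunctions of index $k\ge2$. A *closed curve* is here a smooth $2\pi$-periodic $\gamma$ with $\gamma'(\theta)$ parallel to $p'(\theta)$; its support function is $h=[\gamma,q]$, its dual length is $\int_0^{2\pi}[p,\gamma']\,d\theta$. The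 curve with support function $g$ is $\gamma_g=g\,p+\frac{g'}{[q,q']}\,q$. The double evolute of $\gamma$ is $\gamma-rp-sq$, where $\gamma'=rp'$ and $(\gamma-rp)'=sq'$. Then: 1. $T$ is a bijection from $L_0\cap C^2$ onto $L_0$. Let $S$ be its inverse. For every $C^1$ function $h\in L_0$, the double evolute of $\gamma_{Sh}$ is $\gamma_h$; so $S$ is the (double) involute operator on support functions. 2. If $\gamma$ is a closed curve with support function $h$, then $\gamma=\gamma_h$. If moreover $\gamma$ has zero dual length, there is exactly one $v\in\mathbb R^2$ such that the support function of the translate $\gamma-v$ lies in $C_0$. 3. Every eigenvalue of $T$ belonging to a periodic eigenfunction of index $k\ge2$ is greater than $1$. 4. For every $h\in C_0$, the iterated involutes converge to $0$: $S^nh\to0$ uniformly, and the curves $\gamma_{S^nh}$ converge to $0$ uniformly. 5. For every $h\in C_0$, $h\neq0$, there are $k\ge2$, $\lambda$ and an eigenfunction $u\ne0$ of index $k$ with eigenvalue $\lambda$ such that: $u$ is the orthogonal projection of $h$ onto the $\lambda$-eigenspace; $(k,\lambda)$ is the lowest nonzero mode of $h$, that is, if $v$ is a periodic eigenfunction of index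 $j$ with eigenvalue $\mu$ and $\langle h,v\rangle\ne0$, then $k\le j$ and $\lambda\le\mu$; the curve $\gamma_u$ is a cycloid, its double evolute being $\lambda\gamma_u$; and $\lambda^nS^nh\to u$ uniformly and $\lambda^n\gamma_{S^nh}\to\gamma_u$ uniformly. -/

import Mathlib

open Real Set Filter Topology

noncomputable section

namespace NormedPlane

/-- The determinant `[x, y]` of a pair of vectors of the plane. -/
def det (x y : ℝ × ℝ) : ℝ := x.1 * y.2 - x.2 * y.1

/-- `p` parametrizes the unit circle of the norm `N` by the angle which the tangent makes with a
fixed direction (the direction of polar angle `α`). The speed `ρ` is the Euclidean radius of curvature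
of the unit circle, so smoothness of `p` and `0 < ρ` say that the unit circle is smooth and
quadratically convex. -/
structure IsUnitCircleParam (N : Seminorm ℝ (ℝ × ℝ)) (α : ℝ) (p : ℝ → ℝ × ℝ) : Prop where
  definite : ∀ x, N x = 0 → x = 0
  smooth : ContDiff ℝ (⊤ : ℕ∞) p
  range_eq : range p = {x | N x = 1}
  antiperiodic : ∀ θ, p (θ + π) = -p θ
  tangent_angle : ∀ θ, ∃ ρ : ℝ, 0 < ρ ∧ deriv p θ = ρ • (cos (θ + α), sin (θ + α))

/-- The weight `[p, p']`. -/
def wt (p : ℝ → ℝ × ℝ) (θ : ℝ) : ℝ := det (p θ) (deriv p θ)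

/-- The dual parametrization `q = p' / [p, p']`. -/
def dual (p : ℝ → ℝ × ℝ) (θ : ℝ) : ℝ × ℝ := (wt p θ)⁻¹ • deriv p θ

/-- The weight `[q, q']`. -/
def dualWt (p : ℝ → ℝ × ℝ) (θ : ℝ) : ℝ := det (dual p θ) (deriv (dual p) θ)

/-! ### Curves -/

/-- A closed smooth front parametrized by the angle of its tangent lines: at the parameter `θ` its
tangent line is parallel to `p' θ`. -/
structure IsHedgehog (p γ : ℝ → ℝ × ℝ) : Prop where
  smooth : ContDiff ℝ (⊤ : ℕ∞) γ
  closed : Function.Periodic γ (2 * π)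
  tangent : ∀ θ, det (deriv γ θ) (deriv p θ) = 0

/-- The support function `[γ, q]`. -/
def support (p γ : ℝ → ℝ × ℝ) (θ : ℝ) : ℝ := det (γ θ) (dual p θ)

/-- The curve `g p + (g' / [q, q']) q`, whose support function is `g`. -/
def curveOf (p : ℝ → ℝ × ℝ) (g : ℝ → ℝ) (θ : ℝ) : ℝ × ℝ :=
  g θ • p θ + (deriv g θ / dualWt p θ) • dual p θ

/-- The signed length of `γ` in the dual norm: `γ' = [p, γ'] q`, and `q` runs on the dual unit
circle. -/
def dualLength (p γ : ℝ → ℝ × ℝ) : ℝ := ∫ θ in (0 : ℝ)..(2 * π), det (p θ) (deriv γ θ)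

/-- `η` is the double evolute of `γ`, equivalently `γ` is a (double) involute of `η`: with the
curvature radius `r` of `γ`, defined by `γ' = r p'`, the evolute is `δ = γ - r p`; with the
curvature radius `s` of `δ`, defined by `δ' = s q'`, its evolute is `η = δ - s q`. -/
def IsDoubleEvolute (p γ η : ℝ → ℝ × ℝ) : Prop :=
  ∃ r s : ℝ → ℝ,
    (∀ θ, HasDerivAt γ (r θ • deriv p θ) θ) ∧
    (∀ θ, HasDerivAt (fun t => γ t - r t • p t) (s θ • deriv (dual p) θ) θ) ∧
    (∀ θ, η θ = γ θ - r θ • p θ - s θ • dual p θ)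

/-! ### Function spaces and the operators `T`, `S` -/

/-- The inner product with weight `[p, p']`. -/
def ip (p : ℝ → ℝ × ℝ) (h₁ h₂ : ℝ → ℝ) : ℝ :=
  ∫ θ in (0 : ℝ)..(2 * π), h₁ θ * h₂ θ * wt p θ

/-- The space `L₀` of continuous functions on the circle (continuous `2π`-periodic functions)
that are orthogonal to the constants. -/
def L0 (p : ℝ → ℝ × ℝ) : Set (ℝ → ℝ) :=
  {h | Continuous h ∧ Function.Periodic h (2 * π) ∧
    ∫ θ in (0 : ℝ)..(2 * π), h θ * wt p θ = 0}

/-- `T h = -(1 / [p, p']) (h' / [q, q'])'`. -/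
def T (p : ℝ → ℝ × ℝ) (h : ℝ → ℝ) : ℝ → ℝ :=
  fun θ => -((wt p θ)⁻¹ * deriv (fun t => deriv h t / dualWt p t) θ)

/-- The twice continuously differentiable functions in `L₀`. -/
def D0 (p : ℝ → ℝ × ℝ) : Set (ℝ → ℝ) := {g | g ∈ L0 p ∧ ContDiff ℝ 2 g}

/-- The inverse `S` of `T`: for `h` in `L₀`, `S h` is the `g` in `D0 p` with `T g = h`. -/
def S (p : ℝ → ℝ × ℝ) : (ℝ → ℝ) → (ℝ → ℝ) := Function.invFunOn (T p) (D0 p)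

/-- `u` is a `2π`-periodic eigenfunction of `T` for the eigenvalue `lam`, of index `k`, that is,
with `2 * k` zeros in a period. -/
structure IsMode (p : ℝ → ℝ × ℝ) (k : ℕ) (lam : ℝ) (u : ℝ → ℝ) : Prop where
  contDiff : ContDiff ℝ 2 u
  periodic : Function.Periodic u (2 * π)
  ne_zero : u ≠ 0
  eigen : T p u = lam • u
  index : {θ | θ ∈ Ico 0 (2 * π) ∧ u θ = 0}.encard = 2 * k

/-- The subspace `C₀` of `L₀` generated by the eigenfunctions of index at least two: the closure
of their linear span for the norm of `ip p`. -/
def C0 (p : ℝ → ℝ × ℝ) : Set (ℝ → ℝ) :=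
  {h | h ∈ L0 p ∧ ∀ ε > 0, ∃ g ∈ Submodule.span ℝ {u | ∃ k lam, 2 ≤ k ∧ IsMode p k lam u},
    ip p (h - g) (h - g) < ε}

end NormedPlane

end

/-!
The operator `T` is of Sturm–Liouville type, so its inverse `S` on `L₀` is compact and symmetric for
the inner product `ip p`, and the eigenvectors of `S` span a dense subspace of its range. The
coordinates of the dual curve `q` satisfy `T u = u` and have exactly two zeros in a period. By Sturm
comparison, an eigenfunction with four or more zeros has an eigenvalue greater than one, and one
with two zeros is `π`-antiperiodic, has a single zero in a half period, and is compared with `q`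
there: it belongs to the eigenvalue one and is of the form `[v, q]`. These are the support functions
of points, which explains the translation that brings a closed curve of zero dual length into `C₀`.

On `C₀` all eigenvalues of `S` lie in `(0, 1)`, so its powers converge to zero, and after rescaling
by the largest one that occurs in `h` they converge to the projection of `h` onto its eigenspace.
This convergence takes place in the norm of `ip p`; it is uniform, for functions and for curves,
because `S h` and `(S h)' / [q, q']` are bounded by a multiple of the norm of `h`.
-/

noncomputable section

namespace NormedPlane

/-! ### Compact symmetric operators and the power iteration -/

section SpectralSpan

open Module.End
open scoped InnerProductSpace

section Module

variable {𝕜 E : Type*} [Field 𝕜] [AddCommGroup E] [Module 𝕜 E] {A : Module.End 𝕜 E} {s t : Set 𝕜}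
  {κ : 𝕜} {x : E}

/-- The span of the eigenvectors of `A` whose eigenvalues belong to `s`. -/
def spectralSpan (A : Module.End 𝕜 E) (s : Set 𝕜) : Submodule 𝕜 E :=
  ⨆ κ ∈ s, eigenspace A κ

theorem mem_spectralSpan (hκ : κ ∈ s) (hx : A x = κ • x) : x ∈ spectralSpan A s :=
  Submodule.mem_iSup_of_mem κ (Submodule.mem_iSup_of_mem hκ (mem_eigenspace_iff.2 hx))

theorem spectralSpan_le {F : Submodule 𝕜 E} :
    spectralSpan A s ≤ F ↔ ∀ κ ∈ s, ∀ x, A x = κ • x → x ∈ F := by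
  rw [spectralSpan, iSup₂_le_iff]
  simp only [SetLike.le_def, mem_eigenspace_iff]

theorem spectralSpan_mono (hst : s ⊆ t) : spectralSpan A s ≤ spectralSpan A t :=
  biSup_mono hst

theorem spectralSpan_singleton : spectralSpan A {κ} = eigenspace A κ :=
  iSup_singleton

theorem spectralSpan_union : spectralSpan A (s ∪ t) = spectralSpan A s ⊔ spectralSpan A t :=
  iSup_union

theorem apply_mem_spectralSpan (hx : x ∈ spectralSpan A s) : A x ∈ spectralSpan A s := by
  suffices h : spectralSpan A s ≤ (spectralSpan A s).comap A from h hx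
  refine spectralSpan_le.2 fun κ hκ y hy => Submodule.mem_comap.2 ?_
  rw [hy]
  exact Submodule.smul_mem _ κ (mem_spectralSpan hκ hy)

theorem pow_apply_of_eigenvector (hx : A x = κ • x) (n : ℕ) : (A ^ n) x = κ ^ n • x := by
  induction n with
  | zero => simp
  | succ n ih => rw [pow_succ', Module.End.mul_apply, ih, map_smul, hx, smul_smul, pow_succ]

end Module

section InnerProduct

variable {𝕜 E : Type*} [RCLike 𝕜] [NormedAddCommGroup E] [InnerProductSpace 𝕜 E]

theorem isOrtho_spectralSpan {A : Module.End 𝕜 E} (hA : A.IsSymmetric) {s t : Set 𝕜}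
    (hst : Disjoint s t) : spectralSpan A s ⟂ spectralSpan A t := by
  simp only [spectralSpan, Submodule.isOrtho_iSup_left, Submodule.isOrtho_iSup_right]
  exact fun μ hμ κ hκ => hA.orthogonalFamily_eigenspaces.isOrtho (hst.ne_of_mem hκ hμ)

theorem inner_eq_zero_of_mem_closure {F G : Submodule 𝕜 E} (hFG : F ⟂ G) {x y : E}
    (hx : x ∈ closure (F : Set E)) (hy : y ∈ G) : ⟪x, y⟫_𝕜 = 0 := by
  have hG : y ∈ F.topologicalClosureᗮ := by
    rw [Submodule.orthogonal_closure]
    exact hFG.symm hy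
  exact (Submodule.mem_orthogonal _ y).1 hG x hx

theorem mem_closure_of_mem_closure_sup {F G : Submodule 𝕜 E} (hFG : F ⟂ G) {x : E}
    (hx : x ∈ closure ((F ⊔ G : Submodule 𝕜 E) : Set E)) (hxF : x ∈ Fᗮ) :
    x ∈ closure (G : Set E) := by
  rw [Metric.mem_closure_iff] at hx ⊢
  intro ε hε
  obtain ⟨y, hy, hyε⟩ := hx ε hε
  obtain ⟨f, hf, g, hg, rfl⟩ := Submodule.mem_sup.1 hy
  refine ⟨g, hg, lt_of_le_of_lt ?_ hyε⟩
  have horth : ⟪x - g, -f⟫_𝕜 = 0 := by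
    rw [inner_neg_right, inner_sub_left, (Submodule.mem_orthogonal' F x).1 hxF f hf,
      hFG.symm.inner_eq hg hf, sub_zero, neg_zero]
  have hpyth := norm_add_sq_eq_norm_sq_add_norm_sq_of_inner_eq_zero (x - g) (-f) horth
  rw [dist_eq_norm, dist_eq_norm, show x - (f + g) = x - g + -f by abel]
  nlinarith [norm_nonneg (x - g), norm_nonneg (-f), norm_nonneg (x - g + -f)]

theorem norm_apply_le_of_mem_spectralSpan {A : Module.End 𝕜 E} (hA : A.IsSymmetric) {c : ℝ}
    (hc : 0 ≤ c) {x : E} (hx : x ∈ spectralSpan A (Metric.closedBall 0 c)) :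
    ‖A x‖ ≤ c * ‖x‖ := by
  rw [spectralSpan, iSup_subtype'] at hx
  obtain ⟨f, hf, rfl⟩ := (Submodule.mem_iSup_iff_exists_finsupp _ _).1 hx
  have horth := hA.orthogonalFamily_eigenspaces.comp
    (Subtype.coe_injective : Function.Injective ((↑) : Metric.closedBall (0 : 𝕜) c → 𝕜))
  have hnorm : ‖∑ κ ∈ f.support, f κ‖ ^ 2 = ∑ κ ∈ f.support, ‖f κ‖ ^ 2 :=
    horth.norm_sum (fun κ => ⟨f κ, hf κ⟩) f.support
  have hnorm_smul :
      ‖∑ κ ∈ f.support, (κ : 𝕜) • f κ‖ ^ 2 = ∑ κ ∈ f.support, ‖(κ : 𝕜) • f κ‖ ^ 2 :=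
    horth.norm_sum (fun κ => (κ : 𝕜) • ⟨f κ, hf κ⟩) f.support
  have happly : A (f.sum fun _ y => y) = ∑ κ ∈ f.support, (κ : 𝕜) • f κ := by
    rw [Finsupp.sum, map_sum]
    exact Finset.sum_congr rfl fun κ _ => mem_eigenspace_iff.1 (hf κ)
  refine le_of_sq_le_sq ?_ (by positivity)
  rw [happly, mul_pow, Finsupp.sum, hnorm_smul, hnorm, Finset.mul_sum]
  refine Finset.sum_le_sum fun κ _ => ?_
  rw [norm_smul, mul_pow]
  gcongr
  exact mem_closedBall_zero_iff.1 κ.2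

end InnerProduct

end SpectralSpan

section CompactOperator

open Module.End UniformSpace
open scoped InnerProductSpace

variable {𝕜 E : Type*} [RCLike 𝕜] [NormedAddCommGroup E]

section NormedSpace

variable [NormedSpace 𝕜 E] {A : E →L[𝕜] E}

theorem exists_isCompact_completion_mem (hA : IsCompactOperator A) :
    ∃ K : Set E, IsCompact K ∧ ∀ x ∈ Metric.ball (0 : Completion E) 1,
      A.completion x ∈ ((↑) : E → Completion E) '' K := by
  obtain ⟨K, hK, hAK⟩ :=
    IsCompactOperator.image_ball_subset_compact (f := (A : E →ₗ[𝕜] E)) hA 1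
  refine ⟨K, hK, fun x hx => ?_⟩
  have hdense := Completion.denseRange_coe.open_subset_closure_inter Metric.isOpen_ball hx
  have hclosed := (hK.image (Completion.continuous_coe E)).isClosed
  refine hclosed.closure_subset (map_mem_closure A.completion.continuous hdense ?_)
  rintro _ ⟨hy, y, rfl⟩
  rw [A.completion_apply_coe]
  exact mem_image_of_mem _ (hAK (mem_image_of_mem _ (by simpa using hy)))

theorem isCompactOperator_completion (hA : IsCompactOperator A) :
    IsCompactOperator A.completion := by
  obtain ⟨K, hK, hAK⟩ := exists_isCompact_completion_mem hA
  exact ⟨_, hK.image (Completion.continuous_coe E),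
    mem_of_superset (Metric.ball_mem_nhds _ one_pos) hAK⟩

/-- The image of the unit ball of `E` is relatively compact in `E` itself, so passing to the
completion adds no limit points. -/
theorem exists_completion_apply_eq_coe (hA : IsCompactOperator A) (x : Completion E) :
    ∃ y : E, A.completion x = y := by
  obtain ⟨K, -, hAK⟩ := exists_isCompact_completion_mem hA
  obtain ⟨c, hc, hcx⟩ : ∃ c : 𝕜, c ≠ 0 ∧ c • x ∈ Metric.ball (0 : Completion E) 1 := by
    have hcont : Tendsto (fun c : 𝕜 => c • x) (𝓝[≠] 0) (𝓝 0) :=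
      ((continuous_id.smul continuous_const).tendsto' 0 0 (zero_smul 𝕜 x)).mono_left
        nhdsWithin_le_nhds
    exact ((hcont.eventually_mem (Metric.ball_mem_nhds _ one_pos)).and
      self_mem_nhdsWithin).exists.imp fun c hc => hc.symm
  obtain ⟨y, -, hy⟩ := hAK _ hcx
  refine ⟨c⁻¹ • y, ?_⟩
  rw [Completion.coe_smul, hy, map_smul, inv_smul_smul₀ hc]

theorem exists_mem_spectralSpan_of_completion_eigenvector (hA : IsCompactOperator A) {κ : 𝕜}
    (hκ : κ ≠ 0) {x : Completion E} (hx : A.completion x = κ • x) :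
    ∃ y ∈ spectralSpan (A : Module.End 𝕜 E) {0}ᶜ, x = y := by
  obtain ⟨y, hy⟩ := exists_completion_apply_eq_coe hA x
  have hxy : x = ↑(κ⁻¹ • y) := by rw [Completion.coe_smul, ← hy, hx, inv_smul_smul₀ hκ]
  refine ⟨κ⁻¹ • y, mem_spectralSpan (κ := κ) hκ (Completion.coe_injective E ?_), hxy⟩
  calc ((A (κ⁻¹ • y) : E) : Completion E) = A.completion ↑(κ⁻¹ • y) :=
        (A.completion_apply_coe _).symm
    _ = ↑(κ • κ⁻¹ • y) := by rw [Completion.coe_smul κ, ← hxy, hx]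

theorem finiteDimensional_eigenspace (hA : IsCompactOperator A) {κ : 𝕜} (hκ : κ ≠ 0) :
    FiniteDimensional 𝕜 (eigenspace (A : Module.End 𝕜 E) κ) := by
  have hclosed : IsClosed (eigenspace (A : Module.End 𝕜 E) κ : Set E) := by
    have heq : (eigenspace (A : Module.End 𝕜 E) κ : Set E) = {x | A x = κ • x} :=
      Set.ext fun x => mem_eigenspace_iff
    rw [heq]
    exact isClosed_eq A.continuous (continuous_const_smul κ)
  have hcompact := IsCompactOperator.restrict (f := (A : E →ₗ[𝕜] E)) hA
    ((mem_invtSubmodule_iff_forall_mem_of_mem _).1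
      (eigenspace_mem_invtSubmodule (A : E →ₗ[𝕜] E) κ)) hclosed
  rw [restrict_eigenspace, LinearMap.coe_smul, IsCompactOperator.smul_iff₀ hκ] at hcompact
  exact FiniteDimensional.of_isCompactOperator_id hcompact

end NormedSpace

variable [InnerProductSpace 𝕜 E] {A : E →L[𝕜] E}

theorem isSymmetric_completion (hA : A.IsSymmetric) : A.completion.IsSymmetric := by
  intro x y
  refine Completion.induction_on₂ x y ?_ fun a b => ?_
  · exact isClosed_eq
      (Completion.Continuous.inner (A.completion.continuous.comp continuous_fst) continuous_snd)
      (Completion.Continuous.inner continuous_fst (A.completion.continuous.comp continuous_snd))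
  · change ⟪A.completion a, b⟫_𝕜 = ⟪(a : Completion E), A.completion b⟫_𝕜
    rw [A.completion_apply_coe, A.completion_apply_coe, Completion.inner_coe, Completion.inner_coe]
    exact hA a b

theorem apply_mem_closure_spectralSpan (hA : IsCompactOperator A) (hsymm : A.IsSymmetric) (x : E) :
    A x ∈ closure (spectralSpan (A : Module.End 𝕜 E) {0}ᶜ : Set E) := by
  set F := (spectralSpan (A : Module.End 𝕜 E) {0}ᶜ).map
    (Completion.toComplL : E →L[𝕜] Completion E).toLinearMap
  have hmap : ∀ y ∈ ⨆ κ, eigenspace (A.completion : Module.End 𝕜 (Completion E)) κ,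
      A.completion y ∈ F := by
    suffices h : ⨆ κ, eigenspace (A.completion : Module.End 𝕜 (Completion E)) κ ≤
        F.comap A.completion.toLinearMap from fun y hy => h hy
    refine iSup_le fun κ y hy => ?_
    replace hy : A.completion y = κ • y := mem_eigenspace_iff.1 hy
    change A.completion y ∈ F
    rcases eq_or_ne κ 0 with rfl | hκ
    · rw [hy, zero_smul]
      exact zero_mem F
    · obtain ⟨z, hz, hyz⟩ := exists_mem_spectralSpan_of_completion_eigenvector hA hκ hy
      rw [hy]
      exact F.smul_mem κ (hyz ▸ Submodule.mem_map_of_mem hz)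
  have hdense : (x : Completion E) ∈ closure
      ((⨆ κ, eigenspace (A.completion : Module.End 𝕜 (Completion E)) κ : Submodule 𝕜 _) :
        Set (Completion E)) := by
    rw [← Submodule.topologicalClosure_coe, Submodule.topologicalClosure_eq_top_iff.2
      (ContinuousLinearMap.orthogonalComplement_iSup_eigenspaces_eq_bot
        (isCompactOperator_completion hA) (isSymmetric_completion hsymm))]
    trivial
  rw [(Completion.isUniformInducing_coe E).isInducing.closure_eq_preimage_closure_image,
    mem_preimage, ← A.completion_apply_coe]
  exact map_mem_closure A.completion.continuous hdense hmap

theorem finite_eigenvalues_norm_ge (hA : IsCompactOperator A) (hsymm : A.IsSymmetric) {c : ℝ}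
    (hc : 0 < c) : {κ : 𝕜 | c ≤ ‖κ‖ ∧ HasEigenvalue (A : Module.End 𝕜 E) κ}.Finite := by
  by_contra hinf
  let φ := Set.Infinite.natEmbedding _ hinf
  have hunit : ∀ n, ∃ x : E, ‖x‖ = 1 ∧ A x = (φ n : 𝕜) • x := by
    intro n
    obtain ⟨x, hx⟩ := (φ n).2.2.exists_hasEigenvector
    have hAx : A x = (φ n : 𝕜) • x := hx.apply_eq_smul
    exact ⟨((‖x‖⁻¹ : ℝ) : 𝕜) • x, by rw [RCLike.ofReal_inv]; exact norm_smul_inv_norm hx.2,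
      by rw [map_smul, hAx, smul_comm]⟩
  choose e he hAe using hunit
  obtain ⟨K, hK, hAK⟩ :=
    IsCompactOperator.image_closedBall_subset_compact (f := (A : E →ₗ[𝕜] E)) hA 1
  obtain ⟨y, -, ψ, hψ, hlim⟩ := hK.tendsto_subseq (x := fun n => A (e n)) fun n =>
    hAK (mem_image_of_mem _ (by simp [he]))
  obtain ⟨n, hn⟩ := Metric.cauchySeq_iff'.1 hlim.cauchySeq c hc
  have hclose : ‖A (e (ψ (n + 1))) - A (e (ψ n))‖ < c := by
    simpa only [Function.comp, dist_eq_norm] using hn (n + 1) (Nat.le_succ n)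
  have hne : (φ (ψ (n + 1)) : 𝕜) ≠ φ (ψ n) := fun h =>
    (hψ (Nat.lt_succ_self n)).ne' (φ.injective (Subtype.ext h))
  have horth : ⟪A (e (ψ (n + 1))), -A (e (ψ n))⟫_𝕜 = 0 := by
    rw [hAe, hAe, inner_neg_right, inner_smul_left, inner_smul_right,
      (hsymm.orthogonalFamily_eigenspaces.isOrtho hne).inner_eq
        (mem_eigenspace_iff.2 (hAe _)) (mem_eigenspace_iff.2 (hAe _))]
    simp
  have hpyth := norm_add_sq_eq_norm_sq_add_norm_sq_of_inner_eq_zero _ _ horth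
  have hlarge : c ≤ ‖A (e (ψ (n + 1)))‖ := by
    rw [hAe, norm_smul, he, mul_one]
    exact (φ (ψ (n + 1))).2.1
  rw [← sub_eq_add_neg] at hpyth
  nlinarith [norm_nonneg (A (e (ψ (n + 1))) - A (e (ψ n))), norm_nonneg (-A (e (ψ n)))]

end CompactOperator

section PowerIteration

open Module.End
open scoped InnerProductSpace

section RCLike

variable {𝕜 E : Type*} [RCLike 𝕜] [NormedAddCommGroup E] [InnerProductSpace 𝕜 E] {A : E →L[𝕜] E}

theorem norm_pow_apply_le (hA : A.IsSymmetric) {c : ℝ} (hc : 0 ≤ c) {x : E}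
    (hx : x ∈ closure (spectralSpan (A : Module.End 𝕜 E) (Metric.closedBall 0 c) : Set E))
    (n : ℕ) : ‖(A ^ n) x‖ ≤ c ^ n * ‖x‖ := by
  refine closure_minimal (fun y hy => ?_)
    (isClosed_le (A ^ n).continuous.norm (continuous_const.mul continuous_norm)) hx
  change ‖(A ^ n) y‖ ≤ c ^ n * ‖y‖
  induction n generalizing y with
  | zero => simp
  | succ n ih =>
    calc ‖(A ^ (n + 1)) y‖ = ‖(A ^ n) (A y)‖ := by rw [pow_succ, mul_apply_eq_comp]
      _ ≤ c ^ n * ‖A y‖ := ih (A y) (apply_mem_spectralSpan hy)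
      _ ≤ c ^ n * (c * ‖y‖) := by gcongr; exact norm_apply_le_of_mem_spectralSpan hA hc hy
      _ = c ^ (n + 1) * ‖y‖ := by ring

theorem tendsto_inv_pow_smul_pow_apply_of_mem {κ : 𝕜} {x : E}
    (hx : x ∈ spectralSpan (A : Module.End 𝕜 E) (Metric.ball 0 ‖κ‖)) :
    Tendsto (fun n : ℕ => κ⁻¹ ^ n • (A ^ n) x) atTop (𝓝 0) := by
  let F : Submodule 𝕜 E :=
    { carrier := {y | Tendsto (fun n : ℕ => κ⁻¹ ^ n • (A ^ n) y) atTop (𝓝 0)}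
      zero_mem' := by simp
      add_mem' := fun hy hz => by simpa using Tendsto.add hy hz
      smul_mem' := fun a y hy => by
        have hlim := Tendsto.const_smul (show Tendsto _ _ _ from hy) a
        rw [smul_zero] at hlim
        exact hlim.congr fun n => by rw [map_smul, smul_comm] }
  suffices h : spectralSpan (A : Module.End 𝕜 E) (Metric.ball 0 ‖κ‖) ≤ F from h hx
  refine spectralSpan_le.2 fun μ hμ y hy => ?_
  rw [mem_ball_zero_iff] at hμ
  have hpow : ∀ n : ℕ, κ⁻¹ ^ n • (A ^ n) y = (κ⁻¹ * μ) ^ n • y := fun n => by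
    rw [← ContinuousLinearMap.coe_coe, ContinuousLinearMap.toLinearMap_pow,
      pow_apply_of_eigenvector hy, smul_smul, mul_pow]
  have hlt : ‖κ⁻¹ * μ‖ < 1 := by
    rwa [norm_mul, norm_inv, inv_mul_lt_one₀ ((norm_nonneg μ).trans_lt hμ)]
  change Tendsto _ _ _
  simp_rw [hpow]
  simpa using (tendsto_pow_atTop_nhds_zero_of_norm_lt_one hlt).smul_const y

theorem tendsto_inv_pow_smul_pow_apply (hA : A.IsSymmetric) {κ : 𝕜} (hκ : κ ≠ 0) {x : E}
    (hx : x ∈ closure (spectralSpan (A : Module.End 𝕜 E) (Metric.ball 0 ‖κ‖) : Set E)) :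
    Tendsto (fun n : ℕ => κ⁻¹ ^ n • (A ^ n) x) atTop (𝓝 0) := by
  set F := spectralSpan (A : Module.End 𝕜 E) (Metric.ball 0 ‖κ‖)
  have hbound : ∀ n : ℕ, ∀ y ∈ closure (F : Set E), ‖κ⁻¹ ^ n • (A ^ n) y‖ ≤ ‖y‖ := by
    intro n y hy
    have hκn : 0 < ‖κ‖ ^ n := pow_pos (norm_pos_iff.2 hκ) n
    rw [norm_smul, norm_pow, norm_inv, inv_pow, inv_mul_le_iff₀ hκn]
    exact norm_pow_apply_le hA (norm_nonneg κ)
      (closure_mono (spectralSpan_mono Metric.ball_subset_closedBall) hy) n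
  rw [Metric.tendsto_atTop]
  intro ε hε
  obtain ⟨y, hy, hxy⟩ := Metric.mem_closure_iff.1 hx (ε / 2) (half_pos hε)
  obtain ⟨m, hm⟩ :=
    Metric.tendsto_atTop.1 (tendsto_inv_pow_smul_pow_apply_of_mem hy) (ε / 2) (half_pos hε)
  refine ⟨m, fun n hn => ?_⟩
  have hsub : x - y ∈ closure (F : Set E) := by
    rw [← Submodule.topologicalClosure_coe] at hx ⊢
    exact F.topologicalClosure.sub_mem hx (F.le_topologicalClosure hy)
  calc dist (κ⁻¹ ^ n • (A ^ n) x) 0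
      = ‖κ⁻¹ ^ n • (A ^ n) (x - y) + κ⁻¹ ^ n • (A ^ n) y‖ := by
        rw [dist_zero_right, map_sub, smul_sub, sub_add_cancel]
    _ ≤ ‖κ⁻¹ ^ n • (A ^ n) (x - y)‖ + ‖κ⁻¹ ^ n • (A ^ n) y‖ := norm_add_le _ _
    _ < ε / 2 + ε / 2 := by
        refine add_lt_add ((hbound n _ hsub).trans_lt ?_) ?_
        · rwa [← dist_eq_norm]
        · simpa only [dist_zero_right] using hm n hn
    _ = ε := add_halves ε

/-- The eigenvalues of `A` that a vector `x` sees: those with an eigenvector which is not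
orthogonal to `x`. -/
def spectralSupport (A : Module.End 𝕜 E) (x : E) : Set 𝕜 :=
  {κ | ∃ v, A v = κ • v ∧ ⟪x, v⟫_𝕜 ≠ 0}

variable {s : Set 𝕜} {x : E}

theorem spectralSupport_subset (hA : A.IsSymmetric)
    (hx : x ∈ closure (spectralSpan (A : Module.End 𝕜 E) s : Set E)) :
    spectralSupport (A : Module.End 𝕜 E) x ⊆ s := by
  rintro κ ⟨v, hv, hxv⟩
  by_contra hκ
  exact hxv (inner_eq_zero_of_mem_closure
    (isOrtho_spectralSpan hA (disjoint_singleton_right.2 hκ)) hx (mem_spectralSpan rfl hv))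

theorem spectralSupport_nonempty (hx0 : x ≠ 0)
    (hx : x ∈ closure (spectralSpan (A : Module.End 𝕜 E) s : Set E)) :
    (spectralSupport (A : Module.End 𝕜 E) x).Nonempty := by
  by_contra! hempty
  have horth : spectralSpan (A : Module.End 𝕜 E) s ≤ (𝕜 ∙ x)ᗮ := by
    refine spectralSpan_le.2 fun κ _ v hv => Submodule.mem_orthogonal_singleton_iff_inner_right.2 ?_
    by_contra hne
    exact hempty.subset ⟨v, hv, hne⟩
  have hself : x ∈ (𝕜 ∙ x)ᗮ :=
    closure_minimal (t := ((𝕜 ∙ x)ᗮ : Set E)) horth (Submodule.isClosed_orthogonal _) hx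
  exact hx0 (inner_self_eq_zero.1 (Submodule.mem_orthogonal_singleton_iff_inner_right.1 hself))

end RCLike

variable {E : Type*} [NormedAddCommGroup E] [InnerProductSpace ℝ E] {A : E →L[ℝ] E} {s : Set ℝ}
  {κ : ℝ} {x u : E}

theorem exists_isGreatest_spectralSupport (hA : IsCompactOperator A) (hsymm : A.IsSymmetric)
    (hs : s ⊆ Ioi 0) (hx0 : x ≠ 0)
    (hx : x ∈ closure (spectralSpan (A : Module.End ℝ E) s : Set E)) :
    ∃ κ, IsGreatest (spectralSupport (A : Module.End ℝ E) x) κ := by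
  obtain ⟨c, hc⟩ := spectralSupport_nonempty hx0 hx
  have hc0 : 0 < c := hs (spectralSupport_subset hsymm hx hc)
  have hfinite : (spectralSupport (A : Module.End ℝ E) x ∩ Ici c).Finite := by
    refine (finite_eigenvalues_norm_ge hA hsymm hc0).subset ?_
    rintro κ ⟨⟨v, hv, hxv⟩, hκ⟩
    refine ⟨(mem_Ici.1 hκ).trans (le_abs_self κ),
      hasEigenvalue_of_hasEigenvector ⟨mem_eigenspace_iff.2 hv, ?_⟩⟩
    rintro rfl
    exact hxv (inner_zero_right x)
  obtain ⟨κ, ⟨hκ, hcκ⟩, hmax⟩ := hfinite.exists_maximalFor id _ ⟨c, hc, self_mem_Ici⟩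
  refine ⟨κ, hκ, fun μ hμ => ?_⟩
  rcases le_total μ κ with h | h
  · exact h
  · exact hmax ⟨hμ, (mem_Ici.1 hcκ).trans h⟩ h

theorem sub_mem_closure_spectralSpan_Iio (hsymm : A.IsSymmetric)
    (hx : x ∈ closure (spectralSpan (A : Module.End ℝ E) s : Set E))
    (hκ : κ ∈ upperBounds (spectralSupport (A : Module.End ℝ E) x)) (hu : A u = κ • u)
    (hproj : ∀ v, A v = κ • v → ⟪x - u, v⟫_ℝ = 0) :
    x - u ∈ closure (spectralSpan (A : Module.End ℝ E) (s ∩ Iio κ) : Set E) := by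
  have hdisj : Disjoint (Ici κ) (s ∩ Iio κ) :=
    disjoint_left.2 fun μ hμ hμ' => (mem_Ici.1 hμ).not_gt hμ'.2
  refine mem_closure_of_mem_closure_sup (isOrtho_spectralSpan hsymm hdisj) ?_ ?_
  · rw [← spectralSpan_union, ← Submodule.topologicalClosure_coe]
    refine Submodule.sub_mem _ (closure_mono (spectralSpan_mono fun μ hμ => ?_) hx)
      (Submodule.le_topologicalClosure _ (mem_spectralSpan (Or.inl self_mem_Ici) hu))
    exact (le_or_gt κ μ).imp id fun h => ⟨hμ, h⟩
  · suffices h : spectralSpan (A : Module.End ℝ E) (Ici κ) ≤ (ℝ ∙ (x - u))ᗮ from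
      (Submodule.mem_orthogonal' _ _).2 fun v hv =>
        Submodule.mem_orthogonal_singleton_iff_inner_right.1 (h hv)
    refine spectralSpan_le.2 fun μ hμ v hv =>
      Submodule.mem_orthogonal_singleton_iff_inner_right.2 ?_
    rcases (mem_Ici.1 hμ).eq_or_lt with rfl | hlt
    · exact hproj v hv
    · have hxv : ⟪x, v⟫_ℝ = 0 := by
        by_contra hne
        exact hlt.not_ge (hκ ⟨v, hv, hne⟩)
      rw [inner_sub_left, hxv, (hsymm.orthogonalFamily_eigenspaces.isOrtho hlt.ne).inner_eq
        (mem_eigenspace_iff.2 hu) (mem_eigenspace_iff.2 hv), sub_zero]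

theorem exists_dominant_eigenvector (hA : IsCompactOperator A) (hsymm : A.IsSymmetric)
    (hs : s ⊆ Ioi 0) (hx0 : x ≠ 0)
    (hx : x ∈ closure (spectralSpan (A : Module.End ℝ E) s : Set E)) :
    ∃ κ u, IsGreatest (spectralSupport (A : Module.End ℝ E) x) κ ∧ u ≠ 0 ∧ A u = κ • u ∧
      (∀ v, A v = κ • v → ⟪x - u, v⟫_ℝ = 0) ∧
      Tendsto (fun n : ℕ => κ⁻¹ ^ n • (A ^ n) x) atTop (𝓝 u) := by
  obtain ⟨κ, hκ⟩ := exists_isGreatest_spectralSupport hA hsymm hs hx0 hx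
  have hκ0 : 0 < κ := hs (spectralSupport_subset hsymm hx hκ.1)
  have := finiteDimensional_eigenspace hA hκ0.ne'
  set V := eigenspace (A : Module.End ℝ E) κ
  set u : E := V.starProjection x
  have hu : A u = κ • u := mem_eigenspace_iff.1 (V.starProjection_apply_mem x)
  have hproj : ∀ v, A v = κ • v → ⟪x - u, v⟫_ℝ = 0 := fun v hv =>
    V.starProjection_inner_eq_zero x v (mem_eigenspace_iff.2 hv)
  refine ⟨κ, u, hκ, fun hu0 => ?_, hu, hproj, ?_⟩
  · obtain ⟨v, hv, hxv⟩ := hκ.1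
    exact hxv (by simpa [hu0] using hproj v hv)
  have hball : s ∩ Iio κ ⊆ Metric.ball 0 ‖κ‖ := fun μ hμ => by
    rw [mem_ball_zero_iff, Real.norm_of_nonneg (hs hμ.1).le, Real.norm_of_nonneg hκ0.le]
    exact hμ.2
  have hlim := tendsto_inv_pow_smul_pow_apply hsymm hκ0.ne' (closure_mono (spectralSpan_mono hball)
    (sub_mem_closure_spectralSpan_Iio hsymm hx hκ.2 hu hproj))
  have hfix : ∀ n : ℕ, κ⁻¹ ^ n • (A ^ n) u = u := fun n => by
    rw [← ContinuousLinearMap.coe_coe, ContinuousLinearMap.toLinearMap_pow,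
      pow_apply_of_eigenvector hu, smul_smul, ← mul_pow, inv_mul_cancel₀ hκ0.ne', one_pow, one_smul]
  simpa only [map_sub, smul_sub, hfix, sub_add_cancel, zero_add] using hlim.add_const u

end PowerIteration

/-! ### The unit circle and its dual -/

theorem det_smul_left (a : ℝ) (x y : ℝ × ℝ) : det (a • x) y = a * det x y := by
  simp only [det, Prod.smul_fst, Prod.smul_snd, smul_eq_mul]; ring

theorem det_smul_right (a : ℝ) (x y : ℝ × ℝ) : det x (a • y) = a * det x y := by
  simp only [det, Prod.smul_fst, Prod.smul_snd, smul_eq_mul]; ring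

theorem det_sub_left (x y z : ℝ × ℝ) : det (x - y) z = det x z - det y z := by
  simp only [det, Prod.fst_sub, Prod.snd_sub]; ring

theorem det_neg_left (x y : ℝ × ℝ) : det (-x) y = -det x y := by
  simp only [det, Prod.fst_neg, Prod.snd_neg]; ring

theorem det_neg_right (x y : ℝ × ℝ) : det x (-y) = -det x y := by
  simp only [det, Prod.fst_neg, Prod.snd_neg]; ring

theorem det_self (x : ℝ × ℝ) : det x x = 0 := by
  simp only [det]; ring

theorem det_swap (x y : ℝ × ℝ) : det x y = -det y x := by
  simp only [det]; ring

theorem det_zero_right (x : ℝ × ℝ) : det x 0 = 0 := by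
  simp only [det, Prod.fst_zero, Prod.snd_zero, mul_zero, sub_zero]

theorem eq_det_smul_sub_det_smul {x y : ℝ × ℝ} (h : det x y = 1) (z : ℝ × ℝ) :
    z = det z y • x - det z x • y := by
  simp only [det] at h
  ext
  · simp only [det, Prod.fst_sub, Prod.smul_fst, smul_eq_mul]
    linear_combination (-z.1) * h
  · simp only [det, Prod.snd_sub, Prod.smul_snd, smul_eq_mul]
    linear_combination (-z.2) * h

theorem hasDerivAt_det {f g : ℝ → ℝ × ℝ} {f' g' : ℝ × ℝ} {t : ℝ} (hf : HasDerivAt f f' t)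
    (hg : HasDerivAt g g' t) :
    HasDerivAt (fun s => det (f s) (g s))
      (det f' (g t) + det (f t) g') t := by
  have hf1 : HasDerivAt (fun s => (f s).1) f'.1 t := (hasFDerivAt_fst.comp_hasDerivAt t hf :)
  have hf2 : HasDerivAt (fun s => (f s).2) f'.2 t := (hasFDerivAt_snd.comp_hasDerivAt t hf :)
  have hg1 : HasDerivAt (fun s => (g s).1) g'.1 t := (hasFDerivAt_fst.comp_hasDerivAt t hg :)
  have hg2 : HasDerivAt (fun s => (g s).2) g'.2 t := (hasFDerivAt_snd.comp_hasDerivAt t hg :)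
  refine ((hf1.mul hg2).sub (hf2.mul hg1)).congr_deriv ?_
  simp only [det]
  ring

theorem contDiff_det {n : WithTop ℕ∞} {f g : ℝ → ℝ × ℝ} (hf : ContDiff ℝ n f)
    (hg : ContDiff ℝ n g) : ContDiff ℝ n fun s => det (f s) (g s) :=
  (hf.fst.mul hg.snd).sub (hf.snd.mul hg.fst)

theorem det_deriv_smul {a : ℝ → ℝ} {f : ℝ → ℝ × ℝ} {a' : ℝ} {f' : ℝ × ℝ} {t : ℝ}
    (ha : HasDerivAt a a' t) (hf : HasDerivAt f f' t) :
    det (a t • f t) (deriv (fun s => a s • f s) t) = a t ^ 2 * det (f t) f' := by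
  rw [(ha.fun_smul hf).deriv]
  simp only [det, Prod.smul_fst, Prod.smul_snd, smul_eq_mul, Prod.fst_add, Prod.snd_add]
  ring

/-- The vector of Euclidean length one with polar angle `θ`. -/
def dir (θ : ℝ) : ℝ × ℝ := (cos θ, sin θ)

theorem det_dir (θ τ : ℝ) : det (dir θ) (dir τ) = sin (τ - θ) := by
  rw [sin_sub, det, dir, dir]
  ring

theorem hasDerivAt_dir (θ : ℝ) : HasDerivAt dir (dir (θ + π / 2)) θ := by
  rw [dir, cos_add_pi_div_two, sin_add_pi_div_two]
  exact (hasDerivAt_cos θ).prodMk (hasDerivAt_sin θ)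

namespace IsUnitCircleParam

variable {N : Seminorm ℝ (ℝ × ℝ)} {α : ℝ} {p : ℝ → ℝ × ℝ}

theorem contDiff_deriv (hp : IsUnitCircleParam N α p) : ContDiff ℝ (⊤ : ℕ∞) (deriv p) :=
  ((contDiff_infty_iff_deriv (𝕜 := ℝ)).1 hp.smooth).2

theorem hasDerivAt (hp : IsUnitCircleParam N α p) (θ : ℝ) : HasDerivAt p (deriv p θ) θ :=
  (hp.smooth.differentiable (by simp) θ).hasDerivAt

theorem deriv_eq_smul_dir (hp : IsUnitCircleParam N α p) (θ : ℝ) :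
    ∃ ρ : ℝ, 0 < ρ ∧ deriv p θ = ρ • dir (θ + α) :=
  hp.tangent_angle θ

theorem det_dir_pos (hp : IsUnitCircleParam N α p) (θ : ℝ) : 0 < det (p θ) (dir (θ + α)) := by
  choose ρ hρ hderiv using hp.deriv_eq_smul_dir
  -- Moving from `θ` to `θ + π` the distance to the tangent line at `θ` decreases and changes sign.
  let F : ℝ → ℝ := fun t => det (p t) (dir (θ + α))
  have hF : ∀ t, HasDerivAt F (ρ t * sin (θ - t)) t := by
    intro t
    refine (hasDerivAt_det (hp.hasDerivAt t) (hasDerivAt_const t _)).congr_deriv ?_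
    rw [hderiv, det_smul_left, det_dir, det_zero_right, add_zero, add_sub_add_right_eq_sub]
  have hanti : StrictAntiOn F (Icc θ (θ + π)) := by
    refine strictAntiOn_of_deriv_neg (convex_Icc _ _)
      (fun t _ => (hF t).continuousAt.continuousWithinAt) fun t ht => ?_
    rw [interior_Icc] at ht
    rw [(hF t).deriv]
    exact mul_neg_of_pos_of_neg (hρ t)
      (sin_neg_of_neg_of_neg_pi_lt (by linarith [ht.1]) (by linarith [ht.2]))
  have hlt : F (θ + π) < F θ := hanti (left_mem_Icc.2 (by linarith [pi_pos]))
    (right_mem_Icc.2 (by linarith [pi_pos])) (by linarith [pi_pos])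
  have hneg : F (θ + π) = -F θ := by simp only [F, hp.antiperiodic, det_neg_left]
  change 0 < F θ
  linarith

theorem wt_pos (hp : IsUnitCircleParam N α p) (θ : ℝ) : 0 < wt p θ := by
  obtain ⟨ρ, hρ, hd⟩ := hp.tangent_angle θ
  rw [wt, hd, det_smul_right]
  exact mul_pos hρ (hp.det_dir_pos θ)

theorem contDiff_wt (hp : IsUnitCircleParam N α p) : ContDiff ℝ (⊤ : ℕ∞) (wt p) :=
  contDiff_det hp.smooth hp.contDiff_deriv

theorem contDiff_dual (hp : IsUnitCircleParam N α p) : ContDiff ℝ (⊤ : ℕ∞) (dual p) :=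
  (hp.contDiff_wt.inv fun θ => (hp.wt_pos θ).ne').smul hp.contDiff_deriv

theorem contDiff_dualWt (hp : IsUnitCircleParam N α p) : ContDiff ℝ (⊤ : ℕ∞) (dualWt p) :=
  contDiff_det hp.contDiff_dual ((contDiff_infty_iff_deriv (𝕜 := ℝ)).1 hp.contDiff_dual).2

theorem deriv_eq (hp : IsUnitCircleParam N α p) (θ : ℝ) : deriv p θ = wt p θ • dual p θ := by
  rw [dual, smul_inv_smul₀ (hp.wt_pos θ).ne']

theorem det_dual (hp : IsUnitCircleParam N α p) (θ : ℝ) : det (p θ) (dual p θ) = 1 := by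
  rw [dual, det_smul_right]
  exact inv_mul_cancel₀ (hp.wt_pos θ).ne'

theorem hasDerivAt_dual (hp : IsUnitCircleParam N α p) (θ : ℝ) :
    HasDerivAt (dual p) (-dualWt p θ • p θ) θ := by
  have hq := (hp.contDiff_dual.differentiable (by simp) θ).hasDerivAt
  refine hq.congr_deriv ?_
  have hdet := hasDerivAt_det (hp.hasDerivAt θ) hq
  simp_rw [hp.det_dual] at hdet
  have horth : det (p θ) (deriv (dual p) θ) = 0 := by
    simpa only [hp.deriv_eq, det_smul_left, det_self, mul_zero, zero_add] using
      hdet.unique (hasDerivAt_const θ 1)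
  rw [eq_det_smul_sub_det_smul (hp.det_dual θ) (deriv (dual p) θ), det_swap _ (p θ), horth,
    det_swap, dualWt, neg_zero, zero_smul, sub_zero]

theorem deriv_dual (hp : IsUnitCircleParam N α p) (θ : ℝ) :
    deriv (dual p) θ = -dualWt p θ • p θ := (hp.hasDerivAt_dual θ).deriv

theorem dual_eq (hp : IsUnitCircleParam N α p) (θ : ℝ) :
    dual p θ = (det (p θ) (dir (θ + α)))⁻¹ • dir (θ + α) := by
  obtain ⟨ρ, hρ, hderiv⟩ := hp.deriv_eq_smul_dir θ
  rw [dual, wt, hderiv, det_smul_right, smul_smul, mul_inv, mul_right_comm, inv_mul_cancel₀ hρ.ne',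
    one_mul]

theorem dualWt_eq (hp : IsUnitCircleParam N α p) (θ : ℝ) :
    dualWt p θ = (det (p θ) (dir (θ + α)))⁻¹ ^ 2 := by
  have hdir : HasDerivAt (fun t => dir (t + α)) (dir (θ + α + π / 2)) θ :=
    (hasDerivAt_dir (θ + α)).comp_add_const θ α
  have hinv := (hasDerivAt_det (hp.hasDerivAt θ) hdir).fun_inv (hp.det_dir_pos θ).ne'
  rw [dualWt, funext hp.dual_eq, det_deriv_smul hinv hdir, det_dir, add_sub_cancel_left,
    sin_pi_div_two, mul_one]

theorem dualWt_pos (hp : IsUnitCircleParam N α p) (θ : ℝ) : 0 < dualWt p θ := by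
  rw [hp.dualWt_eq]
  exact pow_pos (inv_pos.2 (hp.det_dir_pos θ)) 2

theorem deriv_antiperiodic (hp : IsUnitCircleParam N α p) : Function.Antiperiodic (deriv p) π := by
  intro θ
  have h : (fun t => p (t + π)) = fun t => -p t := funext hp.antiperiodic
  rw [← deriv_comp_add_const, h, deriv.fun_neg]

theorem wt_periodic (hp : IsUnitCircleParam N α p) : Function.Periodic (wt p) π := by
  intro θ
  rw [wt, hp.antiperiodic, hp.deriv_antiperiodic, det_neg_left, det_neg_right, neg_neg, wt]

theorem dual_antiperiodic (hp : IsUnitCircleParam N α p) : Function.Antiperiodic (dual p) π := by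
  intro θ
  rw [dual, hp.wt_periodic, hp.deriv_antiperiodic, smul_neg, dual]

theorem dualWt_periodic (hp : IsUnitCircleParam N α p) : Function.Periodic (dualWt p) π := by
  intro θ
  have h : (fun t => dual p (t + π)) = fun t => -dual p t := funext hp.dual_antiperiodic
  rw [dualWt, ← deriv_comp_add_const, h, deriv.fun_neg, hp.dual_antiperiodic, det_neg_left,
    det_neg_right, neg_neg, dualWt]

theorem det_dual_dual (hp : IsUnitCircleParam N α p) (θ τ : ℝ) :
    ∃ c > 0, det (dual p θ) (dual p τ) = c * sin (τ - θ) := by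
  refine ⟨(det (p θ) (dir (θ + α)))⁻¹ * (det (p τ) (dir (τ + α)))⁻¹,
    mul_pos (inv_pos.2 (hp.det_dir_pos θ)) (inv_pos.2 (hp.det_dir_pos τ)), ?_⟩
  rw [hp.dual_eq θ, hp.dual_eq τ, det_smul_left, det_smul_right, det_dir, add_sub_add_right_eq_sub,
    mul_assoc]

end IsUnitCircleParam

/-! ### Sturm–Liouville theory with periodic weights -/

section Sturm

theorem forall_pos_or_forall_neg {f : ℝ → ℝ} {s : Set ℝ} (hs : IsPreconnected s)
    (hf : ContinuousOn f s) (h0 : ∀ x ∈ s, f x ≠ 0) :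
    (∀ x ∈ s, 0 < f x) ∨ ∀ x ∈ s, f x < 0 := by
  by_contra! hcon
  obtain ⟨⟨x, hx, hfx⟩, y, hy, hfy⟩ := hcon
  obtain ⟨z, hz, hfz⟩ := hs.intermediate_value hx hy hf ⟨hfx, hfy⟩
  exact h0 z hz hfz

theorem deriv_nonneg_of_nonneg_right {f : ℝ → ℝ} {d a b : ℝ} (hab : a < b) (hf : HasDerivAt f d a)
    (h0 : f a = 0) (hpos : ∀ x ∈ Ioo a b, 0 ≤ f x) : 0 ≤ d := by
  refine ge_of_tendsto (hasDerivAt_iff_tendsto_slope_left_right.1 hf).2 ?_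
  filter_upwards [Ioo_mem_nhdsGT hab] with x hx
  rw [slope_def_field, h0, sub_zero]
  exact div_nonneg (hpos x hx) (sub_nonneg.2 hx.1.le)

theorem deriv_nonpos_of_nonneg_left {f : ℝ → ℝ} {d a b : ℝ} (hab : a < b) (hf : HasDerivAt f d b)
    (h0 : f b = 0) (hpos : ∀ x ∈ Ioo a b, 0 ≤ f x) : d ≤ 0 := by
  refine le_of_tendsto (hasDerivAt_iff_tendsto_slope_left_right.1 hf).1 ?_
  filter_upwards [Ioo_mem_nhdsLT hab] with x hx
  rw [slope_def_field, h0, sub_zero]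
  exact div_nonpos_of_nonneg_of_nonpos (hpos x hx) (sub_nonpos.2 hx.2.le)

theorem toIcoMod_ne_of_lt_of_lt_add {c a x y : ℝ} (hc : 0 < c) (hxy : x < y) (hyx : y < x + c) :
    toIcoMod hc a x ≠ toIcoMod hc a y := by
  intro heq
  have hx := toIcoMod_add_toIcoDiv_mul hc a x
  have hy := toIcoMod_add_toIcoDiv_mul hc a y
  have hsub : y - x = ((toIcoDiv hc a y - toIcoDiv hc a x : ℤ) : ℝ) * c := by
    push_cast
    linarith
  have hpos : (0 : ℝ) < (toIcoDiv hc a y - toIcoDiv hc a x : ℤ) :=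
    pos_of_mul_pos_left (by linarith) hc.le
  have hlt : ((toIcoDiv hc a y - toIcoDiv hc a x : ℤ) : ℝ) < 1 :=
    lt_of_mul_lt_mul_right (by linarith) hc.le
  norm_cast at hpos hlt
  omega

/-- Positive continuous `c`-periodic weights `w` and `z` for the operator
`h ↦ -(1 / w) (h' / z)'`. -/
structure PeriodicWeights (c : ℝ) (w z : ℝ → ℝ) : Prop where
  period_pos : 0 < c
  continuous_left : Continuous w
  continuous_right : Continuous z
  left_pos : ∀ θ, 0 < w θ
  right_pos : ∀ θ, 0 < z θ
  left_periodic : Function.Periodic w c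
  right_periodic : Function.Periodic z c

/-- `g` solves `-(1 / w) (g' / z)' = f`, written as a first order system for `g` and its flux
`m = g' / z`. -/
structure IsSturmSolution (w z f g m : ℝ → ℝ) : Prop where
  hasDerivAt : ∀ θ, HasDerivAt g (z θ * m θ) θ
  hasDerivAt_flux : ∀ θ, HasDerivAt m (-(w θ * f θ)) θ

/-- The number of zeros in the period `[0, c)`. -/
def zeroCount (c : ℝ) (u : ℝ → ℝ) : ℕ∞ := {θ | θ ∈ Ico 0 c ∧ u θ = 0}.encard

variable {c lam mu : ℝ} {w z f f₁ f₂ g g₁ g₂ m m₁ m₂ u v n : ℝ → ℝ}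

theorem PeriodicWeights.two_mul (hW : PeriodicWeights c w z) : PeriodicWeights (2 * c) w z where
  period_pos := mul_pos two_pos hW.period_pos
  continuous_left := hW.continuous_left
  continuous_right := hW.continuous_right
  left_pos := hW.left_pos
  right_pos := hW.right_pos
  left_periodic := hW.left_periodic.nat_mul 2
  right_periodic := hW.right_periodic.nat_mul 2

namespace IsSturmSolution

theorem continuous (H : IsSturmSolution w z f g m) : Continuous g :=
  continuous_iff_continuousAt.2 fun θ => (H.hasDerivAt θ).continuousAt

theorem continuous_flux (H : IsSturmSolution w z f g m) : Continuous m :=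
  continuous_iff_continuousAt.2 fun θ => (H.hasDerivAt_flux θ).continuousAt

theorem deriv_eq (H : IsSturmSolution w z f g m) (θ : ℝ) : deriv g θ = z θ * m θ :=
  (H.hasDerivAt θ).deriv

theorem add (H₁ : IsSturmSolution w z f₁ g₁ m₁) (H₂ : IsSturmSolution w z f₂ g₂ m₂) :
    IsSturmSolution w z (f₁ + f₂) (g₁ + g₂) (m₁ + m₂) where
  hasDerivAt θ := ((H₁.hasDerivAt θ).add (H₂.hasDerivAt θ)).congr_deriv (by
    rw [Pi.add_apply, mul_add])
  hasDerivAt_flux θ := ((H₁.hasDerivAt_flux θ).add (H₂.hasDerivAt_flux θ)).congr_deriv (by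
    rw [Pi.add_apply, mul_add, neg_add])

theorem smul (a : ℝ) (H : IsSturmSolution w z f g m) :
    IsSturmSolution w z (a • f) (a • g) (a • m) where
  hasDerivAt θ := ((H.hasDerivAt θ).const_smul a).congr_deriv (by
    simp only [Pi.smul_apply, smul_eq_mul, mul_left_comm])
  hasDerivAt_flux θ := ((H.hasDerivAt_flux θ).const_smul a).congr_deriv (by
    simp only [Pi.smul_apply, smul_eq_mul, mul_left_comm, mul_neg])

theorem neg (H : IsSturmSolution w z (lam • u) u m) :
    IsSturmSolution w z (lam • -u) (-u) (-m) := by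
  simpa only [smul_comm (-1 : ℝ) lam, neg_one_smul] using H.smul (-1)

theorem add_const (H : IsSturmSolution w z f g m) (a : ℝ) :
    IsSturmSolution w z f (fun θ => g θ + a) m where
  hasDerivAt θ := (H.hasDerivAt θ).add_const a
  hasDerivAt_flux := H.hasDerivAt_flux

theorem comp_add_period (hW : PeriodicWeights c w z) (H : IsSturmSolution w z f g m) :
    IsSturmSolution w z (fun θ => f (θ + c)) (fun θ => g (θ + c)) (fun θ => m (θ + c)) where
  hasDerivAt θ := by
    simpa only [hW.right_periodic θ] using (H.hasDerivAt (θ + c)).comp_add_const θ c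
  hasDerivAt_flux θ := by
    simpa only [hW.left_periodic θ] using (H.hasDerivAt_flux (θ + c)).comp_add_const θ c

theorem flux_eq (H : IsSturmSolution w z f g m) {θ : ℝ} (hz : z θ ≠ 0) :
    m θ = deriv g θ / z θ := by
  rw [H.deriv_eq, mul_div_cancel_left₀ _ hz]

theorem flux_periodic (hW : PeriodicWeights c w z) (H : IsSturmSolution w z f g m)
    (hg : Function.Periodic g c) : Function.Periodic m c := by
  intro θ
  rw [H.flux_eq (hW.right_pos _).ne', H.flux_eq (hW.right_pos _).ne', hW.right_periodic,
    ← deriv_comp_add_const, funext hg]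

theorem hasDerivAt_wronskian (H₁ : IsSturmSolution w z f₁ g₁ m₁)
    (H₂ : IsSturmSolution w z f₂ g₂ m₂) (θ : ℝ) :
    HasDerivAt (fun t => m₁ t * g₂ t - g₁ t * m₂ t)
      (w θ * (g₁ θ * f₂ θ - f₁ θ * g₂ θ)) θ := by
  refine (((H₁.hasDerivAt_flux θ).mul (H₂.hasDerivAt θ)).sub
    ((H₁.hasDerivAt θ).mul (H₂.hasDerivAt_flux θ))).congr_deriv ?_
  ring

theorem eq_zero_of_initial_eq_zero (hw : Bornology.IsBounded (range w))
    (hz : Bornology.IsBounded (range z)) (H : IsSturmSolution w z (lam • u) u m) {a : ℝ}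
    (hu : u a = 0) (hm : m a = 0) : u = 0 := by
  obtain ⟨C, hC⟩ := hw.exists_norm_le
  obtain ⟨D, hD⟩ := hz.exists_norm_le
  let V : ℝ → ℝ × ℝ → ℝ × ℝ := fun t y => (z t • y.2, (-w t * lam) • y.1)
  have hV : ∀ t, LipschitzWith (max (D.toNNReal * 1) (C.toNNReal * ‖lam‖₊ * 1)) (V t) := by
    intro t
    have hzt : ‖z t‖₊ ≤ D.toNNReal := NNReal.le_toNNReal_of_coe_le (hD _ (mem_range_self t))
    have hwt : ‖-w t * lam‖₊ ≤ C.toNNReal * ‖lam‖₊ := by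
      rw [nnnorm_mul, nnnorm_neg]
      exact mul_le_mul_left (NNReal.le_toNNReal_of_coe_le (hC _ (mem_range_self t))) _
    exact (((lipschitzWith_smul (z t)).weaken hzt).comp LipschitzWith.prod_snd).prodMk
      (((lipschitzWith_smul (-w t * lam)).weaken hwt).comp LipschitzWith.prod_fst)
  have hum : (fun t => (u t, m t)) = fun _ => 0 := by
    refine ODE_solution_unique_univ (v := V) (s := fun _ => univ) (t₀ := a)
      (fun t => (hV t).lipschitzOnWith)
      (fun t => ⟨((H.hasDerivAt t).prodMk (H.hasDerivAt_flux t)).congr_deriv ?_, trivial⟩)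
      (fun t => ⟨(hasDerivAt_const t _).congr_deriv ?_, trivial⟩) (Prod.ext hu hm)
    · simp only [V, Pi.smul_apply, smul_eq_mul, neg_mul, mul_assoc]
    · simp only [V, Prod.fst_zero, Prod.snd_zero, smul_zero, Prod.mk_zero_zero]
  exact funext fun t => congrArg Prod.fst (congrFun hum t)

theorem flux_ne_zero (hW : PeriodicWeights c w z) (H : IsSturmSolution w z (lam • u) u m)
    (h0 : u ≠ 0) {a : ℝ} (ha : u a = 0) : m a ≠ 0 := fun hma =>
  have hc := hW.period_pos.ne'
  h0 (H.eq_zero_of_initial_eq_zero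
    (hW.left_periodic.isBounded_of_continuous hc hW.continuous_left)
    (hW.right_periodic.isBounded_of_continuous hc hW.continuous_right) ha hma)

theorem eventually_ne_zero (hW : PeriodicWeights c w z) (H : IsSturmSolution w z (lam • u) u m)
    (h0 : u ≠ 0) {a : ℝ} (ha : u a = 0) : ∀ᶠ x in 𝓝[≠] a, u x ≠ 0 :=
  (H.hasDerivAt a).eventually_ne (mul_ne_zero (hW.right_pos a).ne' (H.flux_ne_zero hW h0 ha))

theorem finite_zeros (hW : PeriodicWeights c w z) (H : IsSturmSolution w z (lam • u) u m)
    (h0 : u ≠ 0) (a b : ℝ) : {θ | θ ∈ Icc a b ∧ u θ = 0}.Finite := by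
  by_contra hinf
  obtain ⟨x, -, hx⟩ := Set.Infinite.exists_accPt_of_subset_isCompact hinf
    (isCompact_Icc (a := a) (b := b)) fun θ hθ => hθ.1
  rw [accPt_iff_frequently_nhdsNE] at hx
  have hzero : ∃ᶠ y in 𝓝[≠] x, u y = 0 := hx.mono fun y hy => hy.2
  have hux : u x = 0 := by
    have hmem : x ∈ closure {θ | u θ = 0} :=
      mem_closure_iff_frequently.2 (hzero.filter_mono nhdsWithin_le_nhds)
    rwa [(isClosed_eq H.continuous continuous_const).closure_eq] at hmem
  exact hzero (H.eventually_ne_zero hW h0 hux)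

theorem exists_next_zero (hW : PeriodicWeights c w z) (H : IsSturmSolution w z (lam • u) u m)
    (h0 : u ≠ 0) {a a' : ℝ} (haa' : a < a') (ha : u a = 0) (ha' : u a' = 0) :
    ∃ b, a < b ∧ u b = 0 ∧ ∀ x ∈ Ioo a b, u x ≠ 0 := by
  have hne : ∀ᶠ x in 𝓝[>] a, u x ≠ 0 :=
    nhdsWithin_mono a (fun x (hx : a < x) => hx.ne') (H.eventually_ne_zero hW h0 ha)
  obtain ⟨d, had, hd⟩ := mem_nhdsGT_iff_exists_Ioo_subset.1 hne
  have hda' : d ≤ a' := not_lt.1 fun hlt => hd ⟨haa', hlt⟩ ha'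
  have hcomp : IsCompact ({x | u x = 0} ∩ Icc d a') :=
    isCompact_Icc.inter_left (isClosed_eq H.continuous continuous_const)
  obtain ⟨b, ⟨hb0, hb⟩, hmin⟩ := hcomp.exists_isLeast ⟨a', ha', hda', le_rfl⟩
  refine ⟨b, had.trans_le hb.1, hb0, fun x hx hx0 => ?_⟩
  rcases lt_or_ge x d with hxd | hdx
  · exact hd ⟨hx.1, hxd⟩ hx0
  · exact absurd (hmin ⟨hx0, hdx, hx.2.le.trans hb.2⟩) (not_le.2 hx.2)

theorem wronskian_monotoneOn (hw : ∀ θ, 0 < w θ) (Hu : IsSturmSolution w z (lam • u) u m)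
    (Hv : IsSturmSolution w z (mu • v) v n) (hle : lam ≤ mu) {a b : ℝ}
    (hpos : ∀ x ∈ Ioo a b, 0 ≤ u x * v x) :
    MonotoneOn (fun t => m t * v t - u t * n t) (Icc a b) := by
  have hW := hasDerivAt_wronskian Hu Hv
  refine monotoneOn_of_deriv_nonneg (convex_Icc _ _)
    (fun t _ => (hW t).continuousAt.continuousWithinAt)
    (fun t _ => (hW t).differentiableAt.differentiableWithinAt) fun t ht => ?_
  rw [interior_Icc] at ht
  have heq : u t * (mu * v t) - lam * u t * v t = (mu - lam) * (u t * v t) := by ring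
  rw [(hW t).deriv, Pi.smul_apply, Pi.smul_apply, smul_eq_mul, smul_eq_mul, heq]
  exact mul_nonneg (hw t).le (mul_nonneg (sub_nonneg.2 hle) (hpos t ht))

theorem not_pos_on_Ico (hW : PeriodicWeights c w z) (Hu : IsSturmSolution w z (lam • u) u m)
    (Hv : IsSturmSolution w z (mu • v) v n) (hle : lam ≤ mu) (hu : u ≠ 0) {a b : ℝ} (hab : a < b)
    (ha : u a = 0) (hb : u b = 0) (hpos : ∀ x ∈ Ioo a b, 0 < u x) :
    ¬ ∀ x ∈ Ico a b, 0 < v x := by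
  intro hv
  have hma : 0 < m a := by
    have hd := deriv_nonneg_of_nonneg_right hab (Hu.hasDerivAt a) ha fun x hx => (hpos x hx).le
    exact (nonneg_of_mul_nonneg_right hd (hW.right_pos a)).lt_of_ne' (Hu.flux_ne_zero hW hu ha)
  have hmb : m b ≤ 0 := by
    have hd := deriv_nonpos_of_nonneg_left hab (Hu.hasDerivAt b) hb fun x hx => (hpos x hx).le
    exact nonpos_of_mul_nonpos_right hd (hW.right_pos b)
  have hvb : 0 ≤ v b := by
    have hmem : b ∈ closure (Ico a b) := by
      rw [closure_Ico hab.ne]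
      exact right_mem_Icc.2 hab.le
    exact closure_minimal (fun x hx => (hv x hx).le) (isClosed_le continuous_const Hv.continuous)
      hmem
  have hmono := wronskian_monotoneOn hW.left_pos Hu Hv hle (a := a) (b := b) fun x hx =>
    (mul_pos (hpos x hx) (hv x (Ioo_subset_Ico_self hx))).le
  have hwronskian := hmono (left_mem_Icc.2 hab.le) (right_mem_Icc.2 hab.le) hab.le
  simp only [ha, hb, zero_mul, sub_zero] at hwronskian
  have hleft := mul_pos hma (hv a (left_mem_Ico.2 hab))
  have hright := mul_nonpos_of_nonpos_of_nonneg hmb hvb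
  linarith

theorem exists_zero_mem_Ico (hW : PeriodicWeights c w z) (Hu : IsSturmSolution w z (lam • u) u m)
    (Hv : IsSturmSolution w z (mu • v) v n) (hle : lam ≤ mu) (hu : u ≠ 0) {a b : ℝ} (hab : a < b)
    (ha : u a = 0) (hb : u b = 0) (hne : ∀ x ∈ Ioo a b, u x ≠ 0) : ∃ d ∈ Ico a b, v d = 0 := by
  by_contra! hv
  wlog hupos : ∀ x ∈ Ioo a b, 0 < u x generalizing u m
  · have huneg := (forall_pos_or_forall_neg isPreconnected_Ioo Hu.continuous.continuousOn
      hne).resolve_left hupos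
    exact this Hu.neg (neg_ne_zero.2 hu) (neg_eq_zero.2 ha) (neg_eq_zero.2 hb)
      (fun x hx => neg_ne_zero.2 (hne x hx)) fun x hx => neg_pos.2 (huneg x hx)
  rcases forall_pos_or_forall_neg isPreconnected_Ico Hv.continuous.continuousOn hv
    with hvpos | hvneg
  · exact not_pos_on_Ico hW Hu Hv hle hu hab ha hb hupos hvpos
  · exact not_pos_on_Ico hW Hu Hv.neg hle hu hab ha hb hupos fun x hx => neg_pos.2 (hvneg x hx)

theorem exists_interlacing (hW : PeriodicWeights c w z) (Hu : IsSturmSolution w z (lam • u) u m)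
    (hper : Function.Periodic u c) (Hv : IsSturmSolution w z (mu • v) v n) (hle : lam ≤ mu)
    (hu : u ≠ 0) : ∃ φ : ℝ → ℝ, ∀ a, u a = 0 →
      v (φ a) = 0 ∧ a ≤ φ a ∧ ∀ b, u b = 0 → a < b → φ a < b := by
  have hex : ∀ a, u a = 0 → ∃ d, v d = 0 ∧ a ≤ d ∧ ∀ b, u b = 0 → a < b → d < b := by
    intro a ha
    obtain ⟨b, hab, hb, hne⟩ := Hu.exists_next_zero hW hu
      (lt_add_of_pos_right a hW.period_pos) ha ((hper a).trans ha)
    obtain ⟨d, hd, hvd⟩ := exists_zero_mem_Ico hW Hu Hv hle hu hab ha hb hne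
    exact ⟨d, hvd, hd.1, fun b' hb' hab' =>
      hd.2.trans_le (not_lt.1 fun hlt => hne b' ⟨hab', hlt⟩ hb')⟩
  choose! φ hφ using hex
  exact ⟨φ, hφ⟩

theorem zeroCount_le (hW : PeriodicWeights c w z) (Hu : IsSturmSolution w z (lam • u) u m)
    (hu : Function.Periodic u c) (Hv : IsSturmSolution w z (mu • v) v n)
    (hv : Function.Periodic v c) (hle : lam ≤ mu) (hu0 : u ≠ 0) :
    zeroCount c u ≤ zeroCount c v := by
  have hc := hW.period_pos
  obtain ⟨φ, hφ⟩ := Hu.exists_interlacing hW hu Hv hle hu0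
  have hinj : ∀ a b, 0 ≤ a → u a = 0 → b < c → u b = 0 → a < b →
      toIcoMod hc 0 (φ a) ≠ toIcoMod hc 0 (φ b) := by
    intro a b ha hua hb hub hab
    have hua' : u (a + c) = 0 := (hu a).trans hua
    refine toIcoMod_ne_of_lt_of_lt_add hc (((hφ a hua).2.2 b hub hab).trans_le (hφ b hub).2.1) ?_
    exact ((hφ b hub).2.2 (a + c) hua' (by linarith)).trans_le (by linarith [(hφ a hua).2.1])
  refine encard_le_encard_of_injOn (f := fun a => toIcoMod hc 0 (φ a)) ?_ ?_
  · rintro a ⟨-, hua⟩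
    refine ⟨toIcoMod_mem_Ico' hc _, ?_⟩
    change v (φ a - toIcoDiv hc 0 (φ a) • c) = 0
    rw [hv.sub_zsmul_eq, (hφ a hua).1]
  · rintro a ⟨ha, hua⟩ b ⟨hb, hub⟩ heq
    rcases lt_trichotomy a b with hlt | rfl | hlt
    · exact absurd heq (hinj a b ha.1 hua hb.2 hub hlt)
    · rfl
    · exact absurd heq.symm (hinj b a hb.1 hub ha.2 hua hlt)

theorem zeroCount_eq (hW : PeriodicWeights c w z) (Hu : IsSturmSolution w z (lam • u) u m)
    (hu : Function.Periodic u c) (hu0 : u ≠ 0) (Hv : IsSturmSolution w z (lam • v) v n)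
    (hv : Function.Periodic v c) (hv0 : v ≠ 0) : zeroCount c u = zeroCount c v :=
  (Hu.zeroCount_le hW hu Hv hv le_rfl hu0).antisymm (Hv.zeroCount_le hW hv Hu hu le_rfl hv0)

theorem exists_zeros_periodic (hW : PeriodicWeights c w z) (H : IsSturmSolution w z (lam • u) u m)
    (hu : Function.Periodic u (2 * c)) (h0 : u ≠ 0) :
    ∃ f l, IsSturmSolution w z (lam • f) f l ∧ Function.Periodic f (2 * c) ∧ f ≠ 0 ∧
      ∀ θ, f (θ + c) = 0 ↔ f θ = 0 := by
  by_cases hanti : Function.Antiperiodic u c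
  · exact ⟨u, m, H, hu, h0, fun θ => by rw [hanti, neg_eq_zero]⟩
  · have hper : Function.Periodic (u + fun θ => u (θ + c)) c := fun θ => by
      have hθ := hu θ
      rw [two_mul, ← add_assoc] at hθ
      rw [Pi.add_apply, Pi.add_apply, hθ, add_comm]
    refine ⟨u + fun θ => u (θ + c), m + fun θ => m (θ + c), ?_, hper.nat_mul 2,
      fun hzero => hanti fun θ => ?_, fun θ => by rw [hper]⟩
    · rw [smul_add]
      exact H.add (H.comp_add_period hW)
    · exact eq_neg_of_add_eq_zero_right (congrFun hzero θ)

theorem exists_zero_of_ne_zero (hW : PeriodicWeights c w z) (H : IsSturmSolution w z (lam • u) u m)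
    (hu : Function.Periodic u c) (hlam : lam ≠ 0) : ∃ θ ∈ Ioo 0 c, u θ = 0 := by
  have hm : m 0 = m c := by simpa only [zero_add] using (H.flux_periodic hW hu 0).symm
  obtain ⟨θ, hθ, hflux⟩ := exists_hasDerivAt_eq_zero hW.period_pos H.continuous_flux.continuousOn hm
    fun θ _ => H.hasDerivAt_flux θ
  refine ⟨θ, hθ, ?_⟩
  simpa only [Pi.smul_apply, smul_eq_mul, neg_eq_zero, mul_eq_zero, (hW.left_pos θ).ne', hlam,
    false_or] using hflux

theorem eq_const_of_eigenvalue_zero (hW : PeriodicWeights c w z)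
    (H : IsSturmSolution w z ((0 : ℝ) • u) u m) (hu : Function.Periodic u c) (θ : ℝ) :
    u θ = u 0 := by
  have hm : ∀ t t', m t = m t' :=
    is_const_of_deriv_eq_zero (fun t => (H.hasDerivAt_flux t).differentiableAt) fun t => by
      rw [(H.hasDerivAt_flux t).deriv, zero_smul, Pi.zero_apply, mul_zero, neg_zero]
  have hper : u 0 = u c := by simpa only [zero_add] using (hu 0).symm
  obtain ⟨ξ, -, hξ⟩ := exists_hasDerivAt_eq_zero hW.period_pos H.continuous.continuousOn hper
    fun t _ => H.hasDerivAt t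
  have hmξ : m ξ = 0 := (mul_eq_zero.1 hξ).resolve_left (hW.right_pos ξ).ne'
  exact is_const_of_deriv_eq_zero (fun t => (H.hasDerivAt t).differentiableAt)
    (fun t => by rw [H.deriv_eq, hm t ξ, hmξ, mul_zero]) θ 0

end IsSturmSolution

theorem zeroCount_two_mul (hc : 0 < c) (hu : ∀ θ, u (θ + c) = 0 ↔ u θ = 0) :
    zeroCount (2 * c) u = 2 * zeroCount c u := by
  have hunion : {θ | θ ∈ Ico 0 (2 * c) ∧ u θ = 0} =
      {θ | θ ∈ Ico 0 c ∧ u θ = 0} ∪ (fun θ => θ + c) '' {θ | θ ∈ Ico 0 c ∧ u θ = 0} := by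
    ext θ
    constructor
    · rintro ⟨hθ, h0⟩
      rcases lt_or_ge θ c with hlt | hge
      · exact Or.inl ⟨⟨hθ.1, hlt⟩, h0⟩
      · refine Or.inr ⟨θ - c, ⟨⟨by linarith, by linarith [hθ.2]⟩, ?_⟩, sub_add_cancel θ c⟩
        rw [← hu, sub_add_cancel]
        exact h0
    · rintro (⟨hθ, h0⟩ | ⟨θ, ⟨hθ, h0⟩, rfl⟩)
      · exact ⟨⟨hθ.1, by linarith [hθ.2]⟩, h0⟩
      · exact ⟨⟨by linarith [hθ.1], by linarith [hθ.2]⟩, (hu θ).2 h0⟩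
  rw [zeroCount, hunion, encard_union_eq, (add_left_injective c).injOn.encard_image, two_mul,
    zeroCount]
  rw [Set.disjoint_left]
  rintro _ ⟨hθ, -⟩ ⟨τ, ⟨hτ, -⟩, rfl⟩
  linarith [hθ.2, hτ.1]

theorem IsSturmSolution.exists_zeroCount_eq_two_mul (hW : PeriodicWeights c w z)
    (H : IsSturmSolution w z (lam • u) u m) (hu : Function.Periodic u (2 * c)) (h0 : u ≠ 0) :
    ∃ k : ℕ, zeroCount (2 * c) u = 2 * k := by
  obtain ⟨f, l, Hf, hf, hf0, hsymm⟩ := H.exists_zeros_periodic hW hu h0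
  have hfin : {θ | θ ∈ Ico 0 c ∧ f θ = 0}.Finite :=
    (Hf.finite_zeros hW hf0 0 c).subset fun θ hθ => ⟨Ico_subset_Icc_self hθ.1, hθ.2⟩
  refine ⟨hfin.toFinset.card, ?_⟩
  rw [H.zeroCount_eq hW.two_mul hu h0 Hf hf hf0, zeroCount_two_mul hW.period_pos hsymm, zeroCount,
    hfin.encard_eq_coe_toFinset_card]

end Sturm

/-! ### The index of an eigenfunction -/

section Index

theorem exists_zero_forall_Ioo_ne {c : ℝ} {u : ℝ → ℝ} (hu : ∀ θ, u (θ + c) = 0 ↔ u θ = 0)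
    (hcount : zeroCount c u = 1) : ∃ a, u a = 0 ∧ ∀ θ ∈ Ioo a (a + c), u θ ≠ 0 := by
  obtain ⟨a, ha⟩ := encard_eq_one.1 hcount
  have hmem : ∀ θ, θ ∈ Ico 0 c ∧ u θ = 0 ↔ θ = a := Set.ext_iff.1 ha
  obtain ⟨haIco, ha0⟩ := (hmem a).2 rfl
  refine ⟨a, ha0, fun θ hθ h0 => ?_⟩
  rcases lt_or_ge θ c with hlt | hge
  · exact hθ.1.ne' ((hmem θ).1 ⟨⟨haIco.1.trans hθ.1.le, hlt⟩, h0⟩)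
  · have hshift : θ - c = a := (hmem _).1 ⟨⟨by linarith, by linarith [hθ.2, haIco.2]⟩, by
      rw [← hu, sub_add_cancel, h0]⟩
    linarith [hθ.2]

variable {N : Seminorm ℝ (ℝ × ℝ)} {α lam : ℝ} {p : ℝ → ℝ × ℝ} {k : ℕ} {f g h m u : ℝ → ℝ}

namespace IsUnitCircleParam

theorem periodicWeights (hp : IsUnitCircleParam N α p) :
    PeriodicWeights π (wt p) (dualWt p) where
  period_pos := pi_pos
  continuous_left := hp.contDiff_wt.continuous
  continuous_right := hp.contDiff_dualWt.continuous
  left_pos := hp.wt_pos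
  right_pos := hp.dualWt_pos
  left_periodic := hp.wt_periodic
  right_periodic := hp.dualWt_periodic

theorem T_eq (hp : IsUnitCircleParam N α p) (H : IsSturmSolution (wt p) (dualWt p) h g m) :
    T p g = h := by
  have hm : (fun t => deriv g t / dualWt p t) = m :=
    funext fun t => (H.flux_eq (hp.dualWt_pos t).ne').symm
  funext θ
  rw [T, hm, (H.hasDerivAt_flux θ).deriv, mul_neg, neg_neg, inv_mul_cancel_left₀ (hp.wt_pos θ).ne']

theorem contDiff_two (hp : IsUnitCircleParam N α p)
    (H : IsSturmSolution (wt p) (dualWt p) h g m) (hh : Continuous h) : ContDiff ℝ 2 g := by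
  have hm : ContDiff ℝ 1 m := by
    refine contDiff_one_iff_deriv.2 ⟨fun θ => (H.hasDerivAt_flux θ).differentiableAt, ?_⟩
    rw [funext fun θ => (H.hasDerivAt_flux θ).deriv]
    exact (hp.contDiff_wt.continuous.mul hh).neg
  rw [← one_add_one_eq_two, contDiff_succ_iff_deriv]
  refine ⟨fun θ => (H.hasDerivAt θ).differentiableAt, by simp, ?_⟩
  rw [funext H.deriv_eq]
  exact (hp.contDiff_dualWt.of_le (by exact_mod_cast le_top)).mul hm

theorem contDiff_deriv_div_dualWt (hp : IsUnitCircleParam N α p) (hg : ContDiff ℝ 2 g) :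
    ContDiff ℝ 1 fun θ => deriv g θ / dualWt p θ := by
  rw [← one_add_one_eq_two, contDiff_succ_iff_deriv] at hg
  exact hg.2.2.div (hp.contDiff_dualWt.of_le (by exact_mod_cast le_top))
    fun θ => (hp.dualWt_pos θ).ne'

theorem isSturmSolution_T (hp : IsUnitCircleParam N α p) (hg : ContDiff ℝ 2 g) :
    IsSturmSolution (wt p) (dualWt p) (T p g) g (fun θ => deriv g θ / dualWt p θ) where
  hasDerivAt θ := by
    rw [mul_div_cancel₀ _ (hp.dualWt_pos θ).ne']
    exact (hg.differentiable two_ne_zero θ).hasDerivAt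
  hasDerivAt_flux θ := by
    have hm := (hp.contDiff_deriv_div_dualWt hg).differentiable one_ne_zero θ
    refine hm.hasDerivAt.congr_deriv ?_
    rw [T, mul_neg, neg_neg, mul_inv_cancel_left₀ (hp.wt_pos θ).ne']

theorem isSturmSolution_det_dual (hp : IsUnitCircleParam N α p) (x : ℝ × ℝ) :
    IsSturmSolution (wt p) (dualWt p) (fun θ => det x (dual p θ)) (fun θ => det x (dual p θ))
      (fun θ => -det x (p θ)) where
  hasDerivAt θ := (hasDerivAt_det (hasDerivAt_const θ x) (hp.hasDerivAt_dual θ)).congr_deriv (by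
    rw [det_smul_right, det_swap, det_zero_right, neg_zero, zero_add, neg_mul, mul_neg])
  hasDerivAt_flux θ := (hasDerivAt_det (hasDerivAt_const θ x) (hp.hasDerivAt θ)).neg.congr_deriv (by
    rw [hp.deriv_eq, det_smul_right, det_swap, det_zero_right, neg_zero, zero_add])

theorem periodic_det_dual (hp : IsUnitCircleParam N α p) (x : ℝ × ℝ) :
    Function.Periodic (fun θ => det x (dual p θ)) (2 * π) :=
  hp.dual_antiperiodic.periodic_two_mul.comp (det x)

-- The point `u p + m q` does not move, since `p' = [p, p'] q` and `q' = -[q, q'] p`.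
theorem exists_eq_det_dual (hp : IsUnitCircleParam N α p)
    (H : IsSturmSolution (wt p) (dualWt p) u u m) :
    ∃ x : ℝ × ℝ, u = fun θ => det x (dual p θ) := by
  let V : ℝ → ℝ × ℝ := fun θ => u θ • p θ + m θ • dual p θ
  have hV : ∀ θ, HasDerivAt V 0 θ := fun θ => by
    refine (((H.hasDerivAt θ).smul (hp.hasDerivAt θ)).add
      ((H.hasDerivAt_flux θ).smul (hp.hasDerivAt_dual θ))).congr_deriv ?_
    rw [hp.deriv_eq]
    module
  refine ⟨V 0, funext fun θ => ?_⟩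
  rw [is_const_of_deriv_eq_zero (fun θ => (hV θ).differentiableAt) (fun θ => (hV θ).deriv) 0 θ,
    show V θ = u θ • p θ - -m θ • dual p θ by rw [neg_smul, sub_neg_eq_add], det_sub_left,
    det_smul_left, det_smul_left, hp.det_dual, det_self, mul_one, mul_zero, sub_zero]

theorem zeroCount_det_dual_le (hp : IsUnitCircleParam N α p) :
    zeroCount (2 * π) (fun θ => det (dual p 0) (dual p θ)) ≤ 2 := by
  have hsub : {θ | θ ∈ Ico 0 π ∧ det (dual p 0) (dual p θ) = 0} ⊆ {0} := by
    rintro θ ⟨hθ, h0⟩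
    obtain ⟨c, hc, heq⟩ := hp.det_dual_dual 0 θ
    rw [heq, sub_zero] at h0
    by_contra hne
    exact (mul_pos hc (sin_pos_of_pos_of_lt_pi (hθ.1.lt_of_ne' hne) hθ.2)).ne' h0
  rw [zeroCount_two_mul pi_pos fun θ => by rw [hp.dual_antiperiodic, det_neg_right, neg_eq_zero]]
  exact mul_le_of_le_one_right' ((encard_le_encard hsub).trans_eq (encard_singleton 0))

-- The Wronskian of `u` and the support function of the point `q a` vanishes at `a` and `a + π`.
theorem eigenvalue_eq_one (hp : IsUnitCircleParam N α p)
    (H : IsSturmSolution (wt p) (dualWt p) (lam • u) u m) {a : ℝ} (ha : u a = 0)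
    (hb : u (a + π) = 0) (hne : ∀ θ ∈ Ioo a (a + π), u θ ≠ 0) : lam = 1 := by
  have Hv := hp.isSturmSolution_det_dual (dual p a)
  have hva : det (dual p a) (dual p a) = 0 := det_self _
  have hvb : det (dual p a) (dual p (a + π)) = 0 := by
    rw [hp.dual_antiperiodic, det_neg_right, det_self, neg_zero]
  have hW := H.hasDerivAt_wronskian Hv
  obtain ⟨ξ, hξ, hzero⟩ := exists_hasDerivAt_eq_zero (lt_add_of_pos_right a pi_pos)
    (fun t _ => (hW t).continuousAt.continuousWithinAt)
    (by simp only [hva, hvb, ha, hb, mul_zero, zero_mul]) fun t _ => hW t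
  obtain ⟨c, hc, heq⟩ := hp.det_dual_dual a ξ
  have hv : det (dual p a) (dual p ξ) ≠ 0 := by
    rw [heq]
    exact (mul_pos hc (sin_pos_of_pos_of_lt_pi (by linarith [hξ.1]) (by linarith [hξ.2]))).ne'
  rw [Pi.smul_apply, smul_eq_mul, mul_assoc, ← one_sub_mul] at hzero
  have hu := hne ξ hξ
  simpa only [mul_eq_zero, (hp.wt_pos ξ).ne', hu, hv, or_false, false_or, sub_eq_zero,
    eq_comm (a := (1 : ℝ))] using hzero

end IsUnitCircleParam

theorem IsSturmSolution.exists_isMode (hp : IsUnitCircleParam N α p)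
    (H : IsSturmSolution (wt p) (dualWt p) (lam • u) u m) (hu : Function.Periodic u (2 * π))
    (h0 : u ≠ 0) : ∃ k, IsMode p k lam u := by
  obtain ⟨k, hk⟩ := H.exists_zeroCount_eq_two_mul hp.periodicWeights hu h0
  exact ⟨k, hp.contDiff_two H (H.continuous.const_smul lam), hu, h0, hp.T_eq H, hk⟩

namespace IsMode

theorem isSturmSolution (hp : IsUnitCircleParam N α p) (hu : IsMode p k lam u) :
    IsSturmSolution (wt p) (dualWt p) (lam • u) u (fun θ => deriv u θ / dualWt p θ) :=
  hu.eigen ▸ hp.isSturmSolution_T hu.contDiff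

theorem zeroCount_eq (hu : IsMode p k lam u) : zeroCount (2 * π) u = 2 * k := hu.index

theorem one_lt (hp : IsUnitCircleParam N α p) (hu : IsMode p k lam u) (hk : 2 ≤ k) :
    1 < lam := by
  by_contra! hle
  have Hv := hp.isSturmSolution_det_dual (dual p 0)
  rw [← one_smul ℝ fun θ => det (dual p 0) (dual p θ)] at Hv
  have hcount := (hu.isSturmSolution hp).zeroCount_le hp.periodicWeights.two_mul hu.periodic
    (by simpa only [one_smul] using Hv) (hp.periodic_det_dual _) hle hu.ne_zero
  rw [hu.zeroCount_eq] at hcount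
  have htwo : 2 * k ≤ 2 := by exact_mod_cast hcount.trans hp.zeroCount_det_dual_le
  omega

theorem index_ne_zero (hp : IsUnitCircleParam N α p) (hu : IsMode p k lam u) (hlam : lam ≠ 0) :
    k ≠ 0 := by
  rintro rfl
  obtain ⟨θ, hθ, h0⟩ := (hu.isSturmSolution hp).exists_zero_of_ne_zero hp.periodicWeights.two_mul
    hu.periodic hlam
  have hempty := hu.index
  rw [Nat.cast_zero, mul_zero, encard_eq_zero] at hempty
  exact hempty.subset ⟨Ioo_subset_Ico_self hθ, h0⟩

theorem index_ne_one (hp : IsUnitCircleParam N α p) (hu : IsMode p k lam u) (hlam : lam ≠ 1) :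
    k ≠ 1 := by
  rintro rfl
  have hW := hp.periodicWeights
  obtain ⟨f, l, Hf, hf, hf0, hsymm⟩ :=
    (hu.isSturmSolution hp).exists_zeros_periodic hW hu.periodic hu.ne_zero
  have hcount : zeroCount π f = 1 := by
    have htwo := hu.zeroCount_eq
    rw [(hu.isSturmSolution hp).zeroCount_eq hW.two_mul hu.periodic hu.ne_zero Hf hf hf0,
      zeroCount_two_mul pi_pos hsymm, Nat.cast_one] at htwo
    exact (ENat.mul_right_strictMono two_ne_zero (ENat.natCast_ne_top 2)).injective htwo
  obtain ⟨a, ha, hne⟩ := exists_zero_forall_Ioo_ne hsymm hcount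
  exact hlam (hp.eigenvalue_eq_one Hf ha ((hsymm a).2 ha) hne)

theorem two_le_index (hp : IsUnitCircleParam N α p) (hu : IsMode p k lam u) (h0 : lam ≠ 0)
    (h1 : lam ≠ 1) : 2 ≤ k := by
  have hk0 := hu.index_ne_zero hp h0
  have hk1 := hu.index_ne_one hp h1
  omega

end IsMode

end Index

/-! ### The solution operator -/

section SolutionOperator

theorem abs_le_integral_abs_deriv {f f' : ℝ → ℝ} {c : ℝ} (hf : ∀ θ, HasDerivAt f (f' θ) θ)
    (hf' : Continuous f') {ξ θ : ℝ} (hξ : ξ ∈ Icc 0 c) (hθ : θ ∈ Icc 0 c) (h0 : f ξ = 0) :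
    |f θ| ≤ ∫ t in (0 : ℝ)..c, |f' t| := by
  have hc : 0 ≤ c := hξ.1.trans hξ.2
  have hftc : ∫ t in ξ..θ, f' t = f θ := by
    rw [intervalIntegral.integral_eq_sub_of_hasDerivAt (fun t _ => hf t)
      (hf'.intervalIntegrable ξ θ), h0, sub_zero]
  calc |f θ| = ‖∫ t in ξ..θ, f' t‖ := by rw [hftc, Real.norm_eq_abs]
    _ ≤ |∫ t in ξ..θ, ‖f' t‖| := intervalIntegral.norm_integral_le_abs_integral_norm
    _ ≤ |∫ t in (0 : ℝ)..c, ‖f' t‖| := by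
        refine intervalIntegral.abs_integral_mono_interval ?_
          (Eventually.of_forall fun t => norm_nonneg _) (hf'.norm.intervalIntegrable _ _)
        rw [uIoc_of_le hc]
        exact Ioc_subset_Ioc (le_min hξ.1 hθ.1) (max_le hξ.2 hθ.2)
    _ = ∫ t in (0 : ℝ)..c, |f' t| :=
        abs_of_nonneg (intervalIntegral.integral_nonneg hc fun t _ => abs_nonneg _)

theorem exists_periodic_primitive {f : ℝ → ℝ} {c : ℝ} (hf : Continuous f)
    (hper : Function.Periodic f c) (h0 : ∫ t in (0 : ℝ)..c, f t = 0) :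
    ∃ F : ℝ → ℝ, Function.Periodic F c ∧ ∀ θ, HasDerivAt F (f θ) θ := by
  refine ⟨fun t => ∫ s in (0 : ℝ)..t, f s, fun t => ?_,
    fun t => (hf.integral_hasStrictDerivAt 0 t).hasDerivAt⟩
  have hperiod : ∫ s in t..t + c, f s = 0 := by
    rw [hper.intervalIntegral_add_eq t 0, zero_add, h0]
  have hsplit := intervalIntegral.integral_add_adjacent_intervals
    (hf.intervalIntegrable (μ := MeasureTheory.volume) 0 t) (hf.intervalIntegrable t (t + c))
  rw [hperiod, add_zero] at hsplit
  exact hsplit.symm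

theorem exists_integral_add_const_mul_eq_zero {f w : ℝ → ℝ} {c : ℝ} (hf : Continuous f)
    (hw : Continuous w) (hI : ∫ t in (0 : ℝ)..c, w t ≠ 0) :
    ∃ C, ∫ t in (0 : ℝ)..c, (f t + C) * w t = 0 := by
  refine ⟨-(∫ t in (0 : ℝ)..c, f t * w t) / ∫ t in (0 : ℝ)..c, w t, ?_⟩
  simp only [add_mul]
  rw [intervalIntegral.integral_add (f := fun t => f t * w t) (g := fun t => _ * w t)
    ((hf.mul hw).intervalIntegrable _ _) ((continuous_const.mul hw).intervalIntegrable _ _),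
    intervalIntegral.integral_const_mul, div_mul_cancel₀ _ hI, add_neg_cancel]

theorem sq_integral_abs_mul_le {f w : ℝ → ℝ} {c : ℝ} (hc : 0 ≤ c) (hf : Continuous f)
    (hw : Continuous w) (hw0 : ∀ t, 0 ≤ w t) :
    (∫ t in (0 : ℝ)..c, |f t| * w t) ^ 2 ≤
      (∫ t in (0 : ℝ)..c, w t) * ∫ t in (0 : ℝ)..c, f t * f t * w t := by
  have hquad : ∀ s : ℝ, 0 ≤ (∫ t in (0 : ℝ)..c, w t) * (s * s) +
      (2 * ∫ t in (0 : ℝ)..c, |f t| * w t) * s + ∫ t in (0 : ℝ)..c, f t * f t * w t := by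
    intro s
    have hexpand : ∫ t in (0 : ℝ)..c, (|f t| + s) ^ 2 * w t =
        (∫ t in (0 : ℝ)..c, w t) * (s * s) +
        (2 * ∫ t in (0 : ℝ)..c, |f t| * w t) * s + ∫ t in (0 : ℝ)..c, f t * f t * w t := by
      have hsq : ∀ t, (|f t| + s) ^ 2 * w t =
          s * s * w t + 2 * s * (|f t| * w t) + f t * f t * w t := fun t => by
        linear_combination w t * sq_abs (f t)
      simp only [hsq]
      rw [intervalIntegral.integral_add, intervalIntegral.integral_add,
        intervalIntegral.integral_const_mul, intervalIntegral.integral_const_mul]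
      · ring
      all_goals exact Continuous.intervalIntegrable (by fun_prop) _ _
    rw [← hexpand]
    exact intervalIntegral.integral_nonneg hc fun t _ => mul_nonneg (sq_nonneg _) (hw0 t)
  have hdisc := discrim_le_zero hquad
  rw [discrim] at hdisc
  linarith

variable {c : ℝ} {w z f g m g₁ g₂ m₁ m₂ : ℝ → ℝ}

namespace PeriodicWeights

theorem integral_left_pos (hW : PeriodicWeights c w z) : 0 < ∫ t in (0 : ℝ)..c, w t :=
  intervalIntegral.intervalIntegral_pos_of_pos (hW.continuous_left.intervalIntegrable _ _)
    hW.left_pos hW.period_pos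

theorem integral_right_pos (hW : PeriodicWeights c w z) : 0 < ∫ t in (0 : ℝ)..c, z t :=
  intervalIntegral.intervalIntegral_pos_of_pos (hW.continuous_right.intervalIntegrable _ _)
    hW.right_pos hW.period_pos

/-- The continuous `c`-periodic functions of mean zero for the weight `w`. -/
def meanZero (hW : PeriodicWeights c w z) : Submodule ℝ (ℝ → ℝ) where
  carrier := {h | Continuous h ∧ Function.Periodic h c ∧ ∫ θ in (0 : ℝ)..c, h θ * w θ = 0}
  zero_mem' := ⟨continuous_const, fun _ => rfl, by
    simp only [Pi.zero_apply, zero_mul, intervalIntegral.integral_zero]⟩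
  add_mem' {f g} hf hg := by
    refine ⟨hf.1.add hg.1, hf.2.1.add hg.2.1, ?_⟩
    simp only [Pi.add_apply, add_mul]
    rw [intervalIntegral.integral_add (f := fun t => f t * w t) (g := fun t => g t * w t)
      ((hf.1.mul hW.continuous_left).intervalIntegrable _ _)
      ((hg.1.mul hW.continuous_left).intervalIntegrable _ _), hf.2.2, hg.2.2, add_zero]
  smul_mem' a f hf := by
    refine ⟨hf.1.const_smul a, hf.2.1.smul a, ?_⟩
    simp only [Pi.smul_apply, smul_eq_mul, mul_assoc]
    rw [intervalIntegral.integral_const_mul, hf.2.2, mul_zero]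

theorem exists_isSturmSolution (hW : PeriodicWeights c w z) (hf : f ∈ hW.meanZero) :
    ∃ g m, IsSturmSolution w z f g m ∧ g ∈ hW.meanZero := by
  obtain ⟨hcont, hper, hmean⟩ := hf
  have hw := hW.continuous_left
  have hz := hW.continuous_right
  obtain ⟨m, hm, hdm⟩ := exists_periodic_primitive (f := fun θ => -(w θ * f θ)) (c := c)
    (hw.mul hcont).neg (fun θ => by simp only [hW.left_periodic θ, hper θ])
    (by simpa only [intervalIntegral.integral_neg, neg_eq_zero, mul_comm] using hmean)
  have hcm : Continuous m := continuous_iff_continuousAt.2 fun θ => (hdm θ).continuousAt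
  obtain ⟨C, hC⟩ := exists_integral_add_const_mul_eq_zero hcm hz hW.integral_right_pos.ne'
  obtain ⟨g, hg, hdg⟩ := exists_periodic_primitive (f := fun θ => (m θ + C) * z θ) (c := c)
    ((hcm.add continuous_const).mul hz) (fun θ => by simp only [hW.right_periodic θ, hm θ]) hC
  have H : IsSturmSolution w z f g fun θ => m θ + C :=
    ⟨fun θ => (hdg θ).congr_deriv (mul_comm _ _), fun θ => (hdm θ).add_const C⟩
  obtain ⟨D, hD⟩ := exists_integral_add_const_mul_eq_zero H.continuous hw hW.integral_left_pos.ne'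
  exact ⟨_, _, H.add_const D, (H.add_const D).continuous, fun θ => by simp only [hg θ], hD⟩

end PeriodicWeights

namespace IsSturmSolution

theorem mem_meanZero (hW : PeriodicWeights c w z) (H : IsSturmSolution w z f g m)
    (hf : Continuous f) (hg : Function.Periodic g c) : f ∈ hW.meanZero := by
  have hm := H.flux_periodic hW hg
  refine ⟨hf, fun θ => ?_, ?_⟩
  · have hshift := (H.comp_add_period hW).hasDerivAt_flux θ
    rw [funext hm] at hshift
    exact mul_left_cancel₀ (hW.left_pos θ).ne' (neg_inj.1 (hshift.unique (H.hasDerivAt_flux θ)))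
  · have hftc := intervalIntegral.integral_eq_sub_of_hasDerivAt
      (fun t (_ : t ∈ uIcc 0 c) => H.hasDerivAt_flux t)
      ((hW.continuous_left.mul hf).neg.intervalIntegrable _ _)
    rw [hm.eq, sub_self] at hftc
    simpa only [intervalIntegral.integral_neg, neg_eq_zero, mul_comm] using hftc

theorem eq_of_mem_meanZero (hW : PeriodicWeights c w z) (H₁ : IsSturmSolution w z f g₁ m₁)
    (hg₁ : g₁ ∈ hW.meanZero) (H₂ : IsSturmSolution w z f g₂ m₂) (hg₂ : g₂ ∈ hW.meanZero) :
    g₁ = g₂ := by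
  obtain ⟨-, hper, hmean⟩ := hW.meanZero.sub_mem hg₁ hg₂
  have H : IsSturmSolution w z ((0 : ℝ) • (g₁ - g₂)) (g₁ - g₂) (m₁ + (-1 : ℝ) • m₂) := by
    have hadd := H₁.add (H₂.smul (-1))
    rwa [neg_one_smul ℝ f, neg_one_smul ℝ g₂, add_neg_cancel, ← sub_eq_add_neg,
      ← zero_smul ℝ (g₁ - g₂)] at hadd
  have hconst := H.eq_const_of_eigenvalue_zero hW hper
  simp only [hconst, intervalIntegral.integral_const_mul, mul_eq_zero, hW.integral_left_pos.ne',
    or_false] at hmean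
  exact sub_eq_zero.1 (funext fun θ => (hconst θ).trans hmean)

theorem abs_flux_le (hW : PeriodicWeights c w z) (H : IsSturmSolution w z f g m)
    (hf : Continuous f) (hg : Function.Periodic g c) (θ : ℝ) :
    |m θ| ≤ ∫ t in (0 : ℝ)..c, |f t| * w t := by
  obtain ⟨ξ, hξ, h0⟩ := exists_hasDerivAt_eq_zero hW.period_pos H.continuous.continuousOn hg.eq.symm
    fun θ _ => H.hasDerivAt θ
  obtain ⟨τ, hτ, hm⟩ := (H.flux_periodic hW hg).exists_mem_Ico₀ hW.period_pos θ
  calc |m θ| = |m τ| := by rw [hm]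
    _ ≤ ∫ t in (0 : ℝ)..c, |-(w t * f t)| :=
        abs_le_integral_abs_deriv H.hasDerivAt_flux (hW.continuous_left.mul hf).neg
          (Ioo_subset_Icc_self hξ) (Ico_subset_Icc_self hτ)
          ((mul_eq_zero.1 h0).resolve_left (hW.right_pos ξ).ne')
    _ = ∫ t in (0 : ℝ)..c, |f t| * w t := by
        simp only [abs_neg, abs_mul, abs_of_pos (hW.left_pos _), mul_comm]

theorem abs_le (hW : PeriodicWeights c w z) (H : IsSturmSolution w z f g m) (hf : Continuous f)
    (hg : g ∈ hW.meanZero) (θ : ℝ) :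
    |g θ| ≤ (∫ t in (0 : ℝ)..c, z t) * ∫ t in (0 : ℝ)..c, |f t| * w t := by
  obtain ⟨hcont, hper, hmean⟩ := hg
  have hz := hW.continuous_right
  obtain ⟨ξ, hξ, hmean_eq⟩ := exists_eq_const_mul_intervalIntegral_of_nonneg
    (μ := MeasureTheory.volume) hcont.continuousOn (hW.continuous_left.intervalIntegrable 0 c)
    fun t _ => (hW.left_pos t).le
  have hgξ : g ξ = 0 :=
    (mul_eq_zero.1 (hmean_eq.symm.trans hmean)).resolve_right hW.integral_left_pos.ne'
  rw [uIcc_of_le hW.period_pos.le] at hξ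
  obtain ⟨τ, hτ, hgτ⟩ := hper.exists_mem_Ico₀ hW.period_pos θ
  rw [hgτ, ← intervalIntegral.integral_mul_const]
  refine (abs_le_integral_abs_deriv H.hasDerivAt (hz.mul H.continuous_flux) hξ
    (Ico_subset_Icc_self hτ) hgξ).trans (intervalIntegral.integral_mono hW.period_pos.le
    ((hz.mul H.continuous_flux).abs.intervalIntegrable _ _)
    ((hz.mul continuous_const).intervalIntegrable _ _) fun t => ?_)
  simp only [abs_mul, abs_of_pos (hW.right_pos t)]
  exact mul_le_mul_of_nonneg_left (H.abs_flux_le hW hf hper t) (hW.right_pos t).le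

end IsSturmSolution

end SolutionOperator

section MeanZeroSpace

theorem isCompact_setOf_lipschitzWith {X Y : Type*} [PseudoMetricSpace X] [MetricSpace Y]
    {s : Set Y} (hs : IsCompact s) (K : NNReal) :
    IsCompact {f : C(X, Y) | (∀ x, f x ∈ s) ∧ LipschitzWith K f} := by
  refine ArzelaAscoli.isCompact_of_equicontinuous _ ?_
    (LipschitzWith.uniformEquicontinuous _ K fun f => f.2.2).equicontinuous
  have himage : ContinuousMap.toFun '' {f : C(X, Y) | (∀ x, f x ∈ s) ∧ LipschitzWith K f} =
      {f : X → Y | (∀ x, f x ∈ s) ∧ LipschitzWith K f} := by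
    ext f
    exact ⟨fun ⟨_, hf, hfeq⟩ => hfeq ▸ hf, fun hf => ⟨⟨f, hf.2.continuous⟩, hf, rfl⟩⟩
  have hclosed : IsClosed {f : X → Y | LipschitzWith K f} := by
    simp only [lipschitzWith_iff_dist_le_mul, Set.ofPred_forall]
    exact isClosed_iInter fun x => isClosed_iInter fun y =>
      isClosed_le ((continuous_apply x).dist (continuous_apply y)) continuous_const
  rw [himage]
  have hpi : {f : X → Y | ∀ x, f x ∈ s} = univ.pi fun _ => s := by
    simp only [Set.pi, mem_univ, forall_const]
  rw [Set.ofPred_and, hpi]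
  exact (isCompact_univ_pi fun _ => hs).inter_right hclosed

variable {c : ℝ} {w z f g m : ℝ → ℝ} {hW : PeriodicWeights c w z}

/-- The space `hW.meanZero` as a type of its own, to carry the norm of the inner product
`∫ f g w`. -/
def MeanZeroSpace (hW : PeriodicWeights c w z) : Type := hW.meanZero

namespace MeanZeroSpace

instance : AddCommGroup (MeanZeroSpace hW) := inferInstanceAs (AddCommGroup hW.meanZero)

instance : Module ℝ (MeanZeroSpace hW) := inferInstanceAs (Module ℝ hW.meanZero)

/-- The underlying function of an element of `MeanZeroSpace hW`. -/
def toFun : MeanZeroSpace hW →ₗ[ℝ] ℝ → ℝ := hW.meanZero.subtype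

theorem toFun_mem (x : MeanZeroSpace hW) : toFun x ∈ hW.meanZero :=
  Subtype.property (p := (· ∈ hW.meanZero)) x

theorem exists_toFun_eq (hf : f ∈ hW.meanZero) : ∃ x : MeanZeroSpace hW, toFun x = f :=
  ⟨(⟨f, hf⟩ : hW.meanZero), rfl⟩

theorem toFun_injective : Function.Injective (toFun : MeanZeroSpace hW → ℝ → ℝ) :=
  Subtype.val_injective

theorem continuous_toFun (x : MeanZeroSpace hW) : Continuous (toFun x) := x.toFun_mem.1

theorem continuous_mul_mul (x y : MeanZeroSpace hW) :
    Continuous fun θ => toFun x θ * toFun y θ * w θ :=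
  (x.continuous_toFun.mul y.continuous_toFun).mul hW.continuous_left

theorem integral_sq_pos {x : MeanZeroSpace hW} (hx : x ≠ 0) :
    0 < ∫ θ in (0 : ℝ)..c, toFun x θ * toFun x θ * w θ := by
  obtain ⟨θ, hθ⟩ := Function.ne_iff.1 ((map_ne_zero_iff toFun toFun_injective).2 hx)
  obtain ⟨τ, hτ, hxτ⟩ := x.toFun_mem.2.1.exists_mem_Ico₀ hW.period_pos θ
  exact intervalIntegral.integral_pos hW.period_pos (x.continuous_mul_mul x).continuousOn
    (fun t _ => mul_nonneg (mul_self_nonneg _) (hW.left_pos t).le)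
    ⟨τ, Ico_subset_Icc_self hτ, mul_pos (mul_self_pos.2 (hxτ ▸ hθ)) (hW.left_pos τ)⟩

instance : InnerProductSpace.Core ℝ (MeanZeroSpace hW) where
  inner x y := ∫ θ in (0 : ℝ)..c, toFun x θ * toFun y θ * w θ
  conj_inner_symm x y := by simp only [conj_trivial, mul_comm (toFun x _)]
  re_inner_nonneg x := intervalIntegral.integral_nonneg hW.period_pos.le fun t _ =>
    mul_nonneg (mul_self_nonneg _) (hW.left_pos t).le
  add_left x y z := by
    simp only [map_add, Pi.add_apply, add_mul]
    exact intervalIntegral.integral_add ((x.continuous_mul_mul z).intervalIntegrable _ _)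
      ((y.continuous_mul_mul z).intervalIntegrable _ _)
  smul_left x y r := by
    simp only [map_smul, Pi.smul_apply, smul_eq_mul, mul_assoc, conj_trivial]
    exact intervalIntegral.integral_const_mul _ _
  definite x hx := by
    by_contra h0
    exact (integral_sq_pos h0).ne' hx

instance : NormedAddCommGroup (MeanZeroSpace hW) :=
  InnerProductSpace.Core.toNormedAddCommGroup (𝕜 := ℝ)

instance : InnerProductSpace ℝ (MeanZeroSpace hW) := InnerProductSpace.ofCore inferInstance

open scoped InnerProductSpace

theorem inner_eq (x y : MeanZeroSpace hW) :
    ⟪x, y⟫_ℝ = ∫ θ in (0 : ℝ)..c, toFun x θ * toFun y θ * w θ := rfl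

theorem integral_abs_mul_le (x : MeanZeroSpace hW) :
    ∫ t in (0 : ℝ)..c, |toFun x t| * w t ≤ √(∫ t in (0 : ℝ)..c, w t) * ‖x‖ := by
  refine le_of_sq_le_sq ?_ (by positivity)
  rw [mul_pow, Real.sq_sqrt hW.integral_left_pos.le, ← real_inner_self_eq_norm_sq]
  exact sq_integral_abs_mul_le hW.period_pos.le x.continuous_toFun hW.continuous_left
    fun t => (hW.left_pos t).le

theorem exists_isSturmSolution (x : MeanZeroSpace hW) :
    ∃ y : MeanZeroSpace hW, ∃ m, IsSturmSolution w z (toFun x) (toFun y) m :=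
  let ⟨g, m, H, hg⟩ := hW.exists_isSturmSolution x.toFun_mem
  ⟨(⟨g, hg⟩ : hW.meanZero), m, H⟩

/-- The linear map sending a right-hand side of mean zero to the solution of mean zero. -/
def solutionMap (hW : PeriodicWeights c w z) : MeanZeroSpace hW →ₗ[ℝ] MeanZeroSpace hW where
  toFun x := x.exists_isSturmSolution.choose
  map_add' x y := by
    obtain ⟨_, H⟩ := (x + y).exists_isSturmSolution.choose_spec
    obtain ⟨_, Hx⟩ := x.exists_isSturmSolution.choose_spec
    obtain ⟨_, Hy⟩ := y.exists_isSturmSolution.choose_spec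
    have Hxy := Hx.add Hy
    rw [← map_add, ← map_add] at Hxy
    exact toFun_injective (H.eq_of_mem_meanZero hW (toFun_mem _) Hxy (toFun_mem _))
  map_smul' a x := by
    obtain ⟨_, H⟩ := (a • x).exists_isSturmSolution.choose_spec
    obtain ⟨_, Hx⟩ := x.exists_isSturmSolution.choose_spec
    have Hax := Hx.smul a
    rw [← map_smul, ← map_smul] at Hax
    exact toFun_injective (H.eq_of_mem_meanZero hW (toFun_mem _) Hax (toFun_mem _))

theorem isSturmSolution_solutionMap (x : MeanZeroSpace hW) :
    IsSturmSolution w z (toFun x) (toFun (solutionMap hW x))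
      (fun θ => deriv (toFun (solutionMap hW x)) θ / z θ) := by
  obtain ⟨m, H⟩ := x.exists_isSturmSolution.choose_spec
  exact funext (fun θ => H.flux_eq (hW.right_pos θ).ne') ▸ H

theorem exists_abs_flux_solutionMap_le (hW : PeriodicWeights c w z) :
    ∃ C, 0 ≤ C ∧ ∀ (x : MeanZeroSpace hW) (θ : ℝ),
      |deriv (toFun (solutionMap hW x)) θ / z θ| ≤ C * ‖x‖ :=
  ⟨√(∫ t in (0 : ℝ)..c, w t), Real.sqrt_nonneg _, fun x θ =>
    (x.isSturmSolution_solutionMap.abs_flux_le hW x.continuous_toFun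
      (solutionMap hW x).toFun_mem.2.1 θ).trans x.integral_abs_mul_le⟩

theorem exists_abs_solutionMap_le (hW : PeriodicWeights c w z) :
    ∃ C, 0 ≤ C ∧ ∀ (x : MeanZeroSpace hW) (θ : ℝ), |toFun (solutionMap hW x) θ| ≤ C * ‖x‖ := by
  refine ⟨(∫ t in (0 : ℝ)..c, z t) * √(∫ t in (0 : ℝ)..c, w t),
    mul_nonneg hW.integral_right_pos.le (Real.sqrt_nonneg _), fun x θ => ?_⟩
  refine (x.isSturmSolution_solutionMap.abs_le hW x.continuous_toFun
    (solutionMap hW x).toFun_mem θ).trans ?_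
  rw [mul_assoc]
  exact mul_le_mul_of_nonneg_left x.integral_abs_mul_le hW.integral_right_pos.le

-- The difference of the two sides is the increment of the Wronskian over a period.
theorem isSymmetric_solutionMap : (solutionMap hW).IsSymmetric := by
  intro x y
  have Hx := x.isSturmSolution_solutionMap
  have Hy := y.isSturmSolution_solutionMap
  have hx := (solutionMap hW x).toFun_mem.2.1
  have hy := (solutionMap hW y).toFun_mem.2.1
  have hwronskian := intervalIntegral.integral_eq_sub_of_hasDerivAt
    (fun t (_ : t ∈ uIcc 0 c) => Hx.hasDerivAt_wronskian Hy t)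
    (Continuous.intervalIntegrable (hW.continuous_left.mul
      ((Hx.continuous.mul y.continuous_toFun).sub (x.continuous_toFun.mul Hy.continuous))) _ _)
  rw [(Hx.flux_periodic hW hx).eq, (Hy.flux_periodic hW hy).eq, hx.eq, hy.eq, sub_self]
    at hwronskian
  rw [← sub_eq_zero, inner_eq, inner_eq, ← intervalIntegral.integral_sub
    ((continuous_mul_mul _ y).intervalIntegrable _ _)
    ((continuous_mul_mul x _).intervalIntegrable _ _)]
  exact (intervalIntegral.integral_congr fun t _ => by ring).trans hwronskian

theorem continuous_integral_mul (hw : Continuous w) :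
    Continuous fun f : C(ℝ, ℝ) => ∫ θ in (0 : ℝ)..c, f θ * w θ := by
  refine intervalIntegral.continuous_parametric_intervalIntegral_of_continuous' ?_ _ _
  exact ((continuous_fst.eval continuous_snd).mul (hw.comp continuous_snd) :
    Continuous fun y : C(ℝ, ℝ) × ℝ => y.1 y.2 * w y.2)

theorem continuous_of_continuous_toFun {X : Type*} [TopologicalSpace X]
    {Φ : X → MeanZeroSpace hW} {F : X → C(ℝ, ℝ)} (hF : Continuous F)
    (hΦ : ∀ a, toFun (Φ a) = F a) : Continuous Φ := by
  refine continuous_iff_continuousAt.2 fun b => tendsto_iff_norm_sub_tendsto_zero.2 ?_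
  have hnorm : ∀ a, ‖Φ a - Φ b‖ =
      √(∫ θ in (0 : ℝ)..c, ((F a - F b) * (F a - F b)) θ * w θ) := fun a => by
    rw [norm_eq_sqrt_real_inner, inner_eq, map_sub, hΦ, hΦ]
    rfl
  have hsub : Continuous fun a => F a - F b := hF.sub continuous_const
  have hcont := ((continuous_integral_mul (c := c) hW.continuous_left).comp (hsub.mul hsub)).sqrt
  have hlim := hcont.tendsto b
  simp only [hnorm]
  simpa [Function.comp_def] using hlim

theorem exists_isCompact_lipschitzWith_mem (hW : PeriodicWeights c w z) (C : ℝ) (K : NNReal) :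
    ∃ A : Set (MeanZeroSpace hW), IsCompact A ∧
      ∀ x, (∀ θ, |toFun x θ| ≤ C) → LipschitzWith K (toFun x) → x ∈ A := by
  let B : Set C(ℝ, ℝ) := {f | (∀ x, f x ∈ Icc (-C) C) ∧ LipschitzWith K f} ∩
    {f | ⇑f ∈ hW.meanZero}
  have hclosed : IsClosed {f : C(ℝ, ℝ) | ⇑f ∈ hW.meanZero} := by
    have hper : IsClosed {f : C(ℝ, ℝ) | ∀ θ, f (θ + c) = f θ} := by
      simp only [Set.ofPred_forall]
      exact isClosed_iInter fun θ => isClosed_eq (by fun_prop) (by fun_prop)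
    have hmean : IsClosed {f : C(ℝ, ℝ) | ∫ θ in (0 : ℝ)..c, f θ * w θ = 0} :=
      isClosed_eq (continuous_integral_mul hW.continuous_left) continuous_const
    convert hper.inter hmean using 1
    exact Set.ext fun f => and_iff_right f.continuous
  have hB : CompactSpace B := isCompact_iff_compactSpace.1
    ((isCompact_setOf_lipschitzWith isCompact_Icc K).inter_right hclosed)
  let Φ : B → MeanZeroSpace hW := fun f => (⟨f.1, f.2.2⟩ : hW.meanZero)
  have hΦ : Continuous Φ := continuous_of_continuous_toFun continuous_subtype_val fun _ => rfl
  exact ⟨range Φ, isCompact_range hΦ, fun x hx hlip =>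
    ⟨⟨⟨toFun x, x.continuous_toFun⟩, ⟨fun θ => abs_le.1 (hx θ), hlip⟩, x.toFun_mem⟩, rfl⟩⟩

theorem isCompactOperator_solutionMap (hW : PeriodicWeights c w z) :
    IsCompactOperator (solutionMap hW) := by
  obtain ⟨Z, hZ⟩ :=
    (hW.right_periodic.isBounded_of_continuous hW.period_pos.ne' hW.continuous_right).exists_norm_le
  have hZ0 : 0 ≤ Z := (norm_nonneg _).trans (hZ _ (mem_range_self 0))
  obtain ⟨M, hM0, hM⟩ := exists_abs_flux_solutionMap_le hW
  obtain ⟨C, hC0, hC⟩ := exists_abs_solutionMap_le hW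
  obtain ⟨A, hA, hmem⟩ := exists_isCompact_lipschitzWith_mem hW C (Z * M).toNNReal
  refine ⟨A, hA, mem_of_superset (Metric.closedBall_mem_nhds 0 one_pos) fun x hx => ?_⟩
  rw [mem_closedBall_zero_iff] at hx
  have H := x.isSturmSolution_solutionMap
  refine hmem _ (fun θ => (hC x θ).trans (mul_le_of_le_one_right hC0 hx)) ?_
  refine lipschitzWith_of_nnnorm_deriv_le (fun θ => (H.hasDerivAt θ).differentiableAt) fun θ => ?_
  rw [← NNReal.coe_le_coe, coe_nnnorm, Real.coe_toNNReal _ (mul_nonneg hZ0 hM0), H.deriv_eq,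
    norm_mul]
  exact mul_le_mul (hZ _ (mem_range_self θ)) ((hM x θ).trans (mul_le_of_le_one_right hM0 hx))
    (abs_nonneg _) hZ0

/-- The linear map `solutionMap` as a continuous operator. -/
def solution (hW : PeriodicWeights c w z) : MeanZeroSpace hW →L[ℝ] MeanZeroSpace hW :=
  ⟨solutionMap hW, (isCompactOperator_solutionMap hW).continuous⟩

end MeanZeroSpace

end MeanZeroSpace

/-! ### The involute operator and the space `C₀` -/

section Involute

variable {N : Seminorm ℝ (ℝ × ℝ)} {α c κ lam : ℝ} {p : ℝ → ℝ × ℝ} {k : ℕ} {w z h m u : ℝ → ℝ}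

namespace MeanZeroSpace

variable {hW : PeriodicWeights c w z} {x y : MeanZeroSpace hW}

theorem solution_eq (H : IsSturmSolution w z (toFun x) (toFun y) m) : solution hW x = y :=
  toFun_injective (x.isSturmSolution_solutionMap.eq_of_mem_meanZero hW (toFun_mem _) H y.toFun_mem)

theorem exists_isSturmSolution_of_solution_eq_smul (hκ : κ ≠ 0) (hx : solution hW x = κ • x) :
    ∃ m, IsSturmSolution w z (κ⁻¹ • toFun x) (toFun x) m := by
  have H := x.isSturmSolution_solutionMap.smul κ⁻¹
  rw [show solutionMap hW x = κ • x from hx, map_smul toFun, inv_smul_smul₀ hκ] at H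
  exact ⟨_, H⟩

theorem exists_solution_eq_inv_smul (hW : PeriodicWeights c w z) (hlam : lam ≠ 0)
    (H : IsSturmSolution w z (lam • u) u m) (hu : Function.Periodic u c) :
    ∃ x : MeanZeroSpace hW, toFun x = u ∧ solution hW x = lam⁻¹ • x := by
  have hmem : u ∈ hW.meanZero :=
    (Submodule.smul_mem_iff _ hlam).1 (H.mem_meanZero hW (H.continuous.const_smul lam) hu)
  obtain ⟨x, rfl⟩ := exists_toFun_eq hmem
  refine ⟨x, rfl, solution_eq (m := lam⁻¹ • m) ?_⟩
  have Hinv := H.smul lam⁻¹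
  rwa [inv_smul_smul₀ hlam, ← map_smul toFun] at Hinv

end MeanZeroSpace

open MeanZeroSpace
open scoped InnerProductSpace

namespace IsUnitCircleParam

/-- The space `L₀` as a type, with the norm of the inner product `ip p`. -/
abbrev L0Space (hp : IsUnitCircleParam N α p) : Type :=
  MeanZeroSpace hp.periodicWeights.two_mul

/-- The involute operator `S` as a bounded operator on `L₀`. -/
abbrev involute (hp : IsUnitCircleParam N α p) : hp.L0Space →L[ℝ] hp.L0Space :=
  solution hp.periodicWeights.two_mul

theorem bijOn_T (hp : IsUnitCircleParam N α p) : BijOn (T p) (D0 p) (L0 p) := by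
  have hW := hp.periodicWeights.two_mul
  refine ⟨fun g hg => ?_, fun g₁ hg₁ g₂ hg₂ heq => ?_, fun h hh => ?_⟩
  · have H := hp.isSturmSolution_T hg.2
    exact H.mem_meanZero hW ((hp.contDiff_wt.continuous.inv₀ fun θ => (hp.wt_pos θ).ne').mul
      (contDiff_one_iff_deriv.1 (hp.contDiff_deriv_div_dualWt hg.2)).2).neg hg.1.2.1
  · have H := hp.isSturmSolution_T hg₁.2
    rw [heq] at H
    exact H.eq_of_mem_meanZero hW hg₁.1 (hp.isSturmSolution_T hg₂.2) hg₂.1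
  · obtain ⟨g, m, H, hg⟩ := hW.exists_isSturmSolution hh
    exact ⟨g, ⟨hg, hp.contDiff_two H hh.1⟩, hp.T_eq H⟩

theorem S_mem_D0 (hp : IsUnitCircleParam N α p) (hh : h ∈ L0 p) : S p h ∈ D0 p :=
  Function.invFunOn_mem (hp.bijOn_T.surjOn hh)

theorem isSturmSolution_S (hp : IsUnitCircleParam N α p) (hh : h ∈ L0 p) :
    IsSturmSolution (wt p) (dualWt p) h (S p h) (fun θ => deriv (S p h) θ / dualWt p θ) := by
  have H := hp.isSturmSolution_T (hp.S_mem_D0 hh).2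
  rwa [show T p (S p h) = h from Function.invFunOn_eq (hp.bijOn_T.surjOn hh)] at H

variable {hp : IsUnitCircleParam N α p} {x : hp.L0Space}

theorem toFun_involute (x : hp.L0Space) : toFun (hp.involute x) = S p (toFun x) :=
  x.isSturmSolution_solutionMap.eq_of_mem_meanZero _ (toFun_mem _)
    (hp.isSturmSolution_S x.toFun_mem) (hp.S_mem_D0 x.toFun_mem).1

theorem toFun_involute_pow (x : hp.L0Space) (n : ℕ) :
    toFun ((hp.involute ^ n) x) = (S p)^[n] (toFun x) := by
  induction n with
  | zero => rfl
  | succ n ih => rw [pow_succ', mul_apply_eq_comp, toFun_involute, ih, Function.iterate_succ_apply']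

theorem exists_isMode_toFun (hx0 : x ≠ 0) (hκ0 : κ ≠ 0) (hκ1 : κ ≠ 1)
    (hx : hp.involute x = κ • x) : ∃ k, 2 ≤ k ∧ IsMode p k κ⁻¹ (toFun x) := by
  obtain ⟨m, H⟩ := exists_isSturmSolution_of_solution_eq_smul hκ0 hx
  obtain ⟨k, hk⟩ := H.exists_isMode hp x.toFun_mem.2.1
    ((map_ne_zero_iff toFun toFun_injective).2 hx0)
  exact ⟨k, hk.two_le_index hp (inv_ne_zero hκ0) (mt inv_eq_one.1 hκ1), hk⟩

end IsUnitCircleParam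

theorem IsMode.exists_involute_eq (hp : IsUnitCircleParam N α p) (hu : IsMode p k lam u)
    (hlam : lam ≠ 0) : ∃ x : hp.L0Space, toFun x = u ∧ hp.involute x = lam⁻¹ • x :=
  exists_solution_eq_inv_smul _ hlam (hu.isSturmSolution hp) hu.periodic

namespace IsUnitCircleParam

theorem span_isMode (hp : IsUnitCircleParam N α p) :
    Submodule.span ℝ {u | ∃ k lam, 2 ≤ k ∧ IsMode p k lam u} =
      (spectralSpan (hp.involute : Module.End ℝ hp.L0Space) (Ioo 0 1)).map toFun := by
  refine le_antisymm (Submodule.span_le.2 ?_)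
    (Submodule.map_le_iff_le_comap.2 (spectralSpan_le.2 fun κ hκ x hx => ?_))
  · rintro u ⟨k, lam, hk, hu⟩
    have hlam := hu.one_lt hp hk
    obtain ⟨x, rfl, hx⟩ := hu.exists_involute_eq hp (by linarith)
    exact Submodule.mem_map_of_mem
      (mem_spectralSpan ⟨inv_pos.2 (by linarith), inv_lt_one_of_one_lt₀ hlam⟩ hx)
  · rcases eq_or_ne x 0 with rfl | hx0
    · exact zero_mem _
    obtain ⟨k, hk, hmode⟩ := exists_isMode_toFun hx0 hκ.1.ne' hκ.2.ne hx
    exact Submodule.subset_span ⟨k, _, hk, hmode⟩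

theorem toFun_mem_C0_iff {hp : IsUnitCircleParam N α p} {x : hp.L0Space} :
    toFun x ∈ C0 p ↔ x ∈ closure
      (spectralSpan (hp.involute : Module.End ℝ hp.L0Space) (Ioo 0 1) : Set hp.L0Space) := by
  have hdist : ∀ y : hp.L0Space,
      ip p (toFun x - toFun y) (toFun x - toFun y) = dist x y ^ 2 := fun y => by
    rw [dist_eq_norm, ← real_inner_self_eq_norm_sq, inner_eq, map_sub]
    rfl
  rw [C0, mem_ofPred_eq, hp.span_isMode, Metric.mem_closure_iff,
    and_iff_right (show toFun x ∈ L0 p from x.toFun_mem)]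
  constructor
  · intro hx ε hε
    obtain ⟨_, ⟨y, hy, rfl⟩, hlt⟩ := hx (ε ^ 2) (by positivity)
    rw [hdist] at hlt
    exact ⟨y, hy, lt_of_pow_lt_pow_left₀ 2 hε.le hlt⟩
  · intro hx ε hε
    obtain ⟨y, hy, hlt⟩ := hx (√ε) (Real.sqrt_pos.2 hε)
    refine ⟨toFun y, Submodule.mem_map_of_mem hy, ?_⟩
    rw [hdist]
    exact (Real.lt_sqrt dist_nonneg).1 hlt

theorem sub_mem_C0 (hp : IsUnitCircleParam N α p) {f g : ℝ → ℝ} (hf : f ∈ C0 p) (hg : g ∈ C0 p) :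
    f - g ∈ C0 p := by
  obtain ⟨x, rfl⟩ := exists_toFun_eq (hW := hp.periodicWeights.two_mul) hf.1
  obtain ⟨y, rfl⟩ := exists_toFun_eq (hW := hp.periodicWeights.two_mul) hg.1
  rw [toFun_mem_C0_iff (hp := hp), ← Submodule.topologicalClosure_coe] at hf hg
  rw [← map_sub, toFun_mem_C0_iff (hp := hp), ← Submodule.topologicalClosure_coe]
  exact Submodule.sub_mem _ hf hg

theorem involute_eq_self_iff {hp : IsUnitCircleParam N α p} {x : hp.L0Space} :
    hp.involute x = x ↔ ∃ v, toFun x = fun θ => det v (dual p θ) := by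
  constructor
  · intro hx
    obtain ⟨m, H⟩ := exists_isSturmSolution_of_solution_eq_smul one_ne_zero
      (hx.trans (one_smul ℝ x).symm)
    rw [inv_one, one_smul] at H
    exact hp.exists_eq_det_dual H
  · rintro ⟨v, hv⟩
    have H := hp.isSturmSolution_det_dual v
    rw [← hv] at H
    exact solution_eq H

theorem exists_toFun_eq_det_dual (hp : IsUnitCircleParam N α p) (v : ℝ × ℝ) :
    ∃ y : hp.L0Space, toFun y = fun θ => det v (dual p θ) :=
  exists_toFun_eq ((hp.isSturmSolution_det_dual v).mem_meanZero _
    (hp.isSturmSolution_det_dual v).continuous (hp.periodic_det_dual v))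

theorem spectralSpan_involute_le (hp : IsUnitCircleParam N α p) :
    spectralSpan (hp.involute : Module.End ℝ hp.L0Space) {0}ᶜ ≤
      spectralSpan (hp.involute : Module.End ℝ hp.L0Space) ({1} ∪ Ioo 0 1) := by
  refine spectralSpan_le.2 fun κ hκ0 x hx => ?_
  rcases eq_or_ne x 0 with rfl | hx0
  · exact zero_mem _
  refine mem_spectralSpan (or_iff_not_imp_left.2 fun hκ1 => ?_) hx
  obtain ⟨k, hk, hmode⟩ := exists_isMode_toFun hx0 hκ0 hκ1 hx
  exact (one_lt_inv_iff₀).1 (hmode.one_lt hp hk)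

theorem isOrtho_spectralSpan_involute (hp : IsUnitCircleParam N α p) :
    spectralSpan (hp.involute : Module.End ℝ hp.L0Space) {1} ⟂
      spectralSpan (hp.involute : Module.End ℝ hp.L0Space) (Ioo 0 1) :=
  isOrtho_spectralSpan isSymmetric_solutionMap
    (disjoint_singleton_left.2 fun h => lt_irrefl _ h.2)

-- By completeness of the eigenfunctions, the fixed points of `S` are all that `C₀` misses.
theorem exists_involute_sub_mem_closure {hp : IsUnitCircleParam N α p} (x : hp.L0Space) :
    ∃ y : hp.L0Space, hp.involute y = y ∧ hp.involute x - y ∈ closure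
      (spectralSpan (hp.involute : Module.End ℝ hp.L0Space) (Ioo 0 1) : Set hp.L0Space) := by
  have hcompact : IsCompactOperator hp.involute := isCompactOperator_solutionMap _
  have := finiteDimensional_eigenspace hcompact (one_ne_zero (α := ℝ))
  set V := Module.End.eigenspace (hp.involute : Module.End ℝ hp.L0Space) 1
  have hfix : ∀ z ∈ V, hp.involute z = z := fun z hz =>
    (Module.End.mem_eigenspace_iff.1 hz).trans (one_smul ℝ z)
  have hproj : V.starProjection (hp.involute x) ∈ V := V.starProjection_apply_mem _
  refine ⟨_, hfix _ hproj, mem_closure_of_mem_closure_sup hp.isOrtho_spectralSpan_involute ?_ ?_⟩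
  swap
  · rw [spectralSpan_singleton]
    exact V.sub_starProjection_mem_orthogonal _
  rw [← spectralSpan_union]
  refine closure_mono hp.spectralSpan_involute_le ?_
  rw [← hfix _ hproj, ← map_sub]
  exact apply_mem_closure_spectralSpan hcompact isSymmetric_solutionMap _

theorem eq_zero_of_det_dual_mem_C0 (hp : IsUnitCircleParam N α p) {v : ℝ × ℝ}
    (hv : (fun θ => det v (dual p θ)) ∈ C0 p) : v = 0 := by
  obtain ⟨y, hy⟩ := hp.exists_toFun_eq_det_dual v
  have hyfix : hp.involute y = (1 : ℝ) • y :=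
    (involute_eq_self_iff.2 ⟨v, hy⟩).trans (one_smul ℝ y).symm
  rw [← hy, toFun_mem_C0_iff] at hv
  have hself : ⟪y, y⟫_ℝ = 0 := inner_eq_zero_of_mem_closure
    hp.isOrtho_spectralSpan_involute.symm hv (mem_spectralSpan rfl hyfix)
  have hzero : ∀ θ, det v (dual p θ) = 0 := by
    rw [inner_self_eq_zero.1 hself, map_zero] at hy
    exact fun θ => (congrFun hy θ).symm
  have hflux : det v (p 0) = 0 := by
    have hder := (hp.isSturmSolution_det_dual v).hasDerivAt 0
    rw [funext hzero] at hder
    have := hder.unique (hasDerivAt_const 0 0)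
    simpa only [mul_neg, neg_eq_zero, mul_eq_zero, (hp.dualWt_pos 0).ne', false_or] using this
  rw [eq_det_smul_sub_det_smul (hp.det_dual 0) v, hzero, hflux, zero_smul, zero_smul, sub_zero]

theorem existsUnique_sub_det_dual_mem_C0 (hp : IsUnitCircleParam N α p) (hh : h ∈ D0 p) :
    ∃! v : ℝ × ℝ, (fun θ => h θ - det v (dual p θ)) ∈ C0 p := by
  refine existsUnique_of_exists_of_unique ?_ fun v v' hv hv' => ?_
  · obtain ⟨x, hx⟩ := exists_toFun_eq (hW := hp.periodicWeights.two_mul) (hp.bijOn_T.mapsTo hh)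
    have hSx : toFun (hp.involute x) = h := by
      rw [toFun_involute, hx]
      exact hp.bijOn_T.injOn.leftInvOn_invFunOn hh
    obtain ⟨y, hy, hmem⟩ := exists_involute_sub_mem_closure x
    obtain ⟨v, hv⟩ := involute_eq_self_iff.1 hy
    rw [← toFun_mem_C0_iff (hp := hp), map_sub, hSx, hv] at hmem
    exact ⟨v, hmem⟩
  · have hmem := hp.sub_mem_C0 hv' hv
    refine sub_eq_zero.1 (hp.eq_zero_of_det_dual_mem_C0 (v := v - v') ?_)
    convert hmem using 2 with θ
    rw [Pi.sub_apply, sub_sub_sub_cancel_left, det_sub_left]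

end IsUnitCircleParam

end Involute

/-! ### Curves and their double evolutes -/

section Curves

variable {N : Seminorm ℝ (ℝ × ℝ)} {α : ℝ} {p γ : ℝ → ℝ × ℝ} {f g h m : ℝ → ℝ}

-- Both `γ = g p + m q`, whose radius is `g - h`, and its evolute `h p + m q` are explicit.
theorem IsSturmSolution.isDoubleEvolute (hp : IsUnitCircleParam N α p)
    (H : IsSturmSolution (wt p) (dualWt p) h g m) (hh : Differentiable ℝ h) :
    IsDoubleEvolute p (curveOf p g) (curveOf p h) := by
  have hp' : ∀ θ, HasDerivAt p (wt p θ • dual p θ) θ := fun θ => hp.deriv_eq θ ▸ hp.hasDerivAt θ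
  have hγ : curveOf p g = fun t => g t • p t + m t • dual p t :=
    funext fun t => by rw [curveOf, H.flux_eq (hp.dualWt_pos t).ne']
  have hδ : (fun t => curveOf p g t - (g t - h t) • p t) =
      fun t => h t • p t + m t • dual p t := by
    rw [hγ]
    exact funext fun t => by module
  refine ⟨fun t => g t - h t, fun t => m t - deriv h t / dualWt p t, fun θ => ?_, fun θ => ?_,
    fun θ => ?_⟩
  · rw [hγ, hp.deriv_eq]
    refine (((H.hasDerivAt θ).fun_smul (hp' θ)).fun_add
      ((H.hasDerivAt_flux θ).fun_smul (hp.hasDerivAt_dual θ))).congr_deriv ?_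
    module
  · rw [hδ, hp.deriv_dual]
    refine (((hh θ).hasDerivAt.fun_smul (hp' θ)).fun_add
      ((H.hasDerivAt_flux θ).fun_smul (hp.hasDerivAt_dual θ))).congr_deriv ?_
    have hcancel : deriv h θ = deriv h θ / dualWt p θ * dualWt p θ :=
      (div_mul_cancel₀ _ (hp.dualWt_pos θ).ne').symm
    nth_rw 1 [hcancel]
    module
  · rw [hγ, curveOf]
    module

namespace IsHedgehog

theorem hasDerivAt (hγ : IsHedgehog p γ) (θ : ℝ) : HasDerivAt γ (deriv γ θ) θ :=
  (hγ.smooth.differentiable (by simp) θ).hasDerivAt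

theorem contDiff_support (hp : IsUnitCircleParam N α p) (hγ : IsHedgehog p γ) :
    ContDiff ℝ (⊤ : ℕ∞) (support p γ) :=
  contDiff_det hγ.smooth hp.contDiff_dual

theorem hasDerivAt_support (hp : IsUnitCircleParam N α p) (hγ : IsHedgehog p γ) (θ : ℝ) :
    HasDerivAt (support p γ) (dualWt p θ * -det (γ θ) (p θ)) θ := by
  refine (hasDerivAt_det (hγ.hasDerivAt θ) (hp.hasDerivAt_dual θ)).congr_deriv ?_
  rw [det_smul_right, dual, det_smul_right, hγ.tangent]
  ring

theorem curveOf_support (hp : IsUnitCircleParam N α p) (hγ : IsHedgehog p γ) :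
    curveOf p (support p γ) = γ := by
  funext θ
  conv_rhs => rw [eq_det_smul_sub_det_smul (hp.det_dual θ) (γ θ)]
  rw [curveOf, (hγ.hasDerivAt_support hp θ).deriv, mul_div_cancel_left₀ _ (hp.dualWt_pos θ).ne',
    support, neg_smul, sub_eq_add_neg]

theorem dualLength_eq (hp : IsUnitCircleParam N α p) (hγ : IsHedgehog p γ) :
    dualLength p γ = ∫ θ in (0 : ℝ)..(2 * π), support p γ θ * wt p θ := by
  have hder : ∀ θ, HasDerivAt (fun t => det (p t) (γ t))
      (det (p θ) (deriv γ θ) - support p γ θ * wt p θ) θ := fun θ => by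
    refine (hasDerivAt_det (hp.hasDerivAt θ) (hγ.hasDerivAt θ)).congr_deriv ?_
    rw [hp.deriv_eq, det_smul_left, support, det_swap (dual p θ)]
    ring
  have hlength : Continuous fun θ => det (p θ) (deriv γ θ) :=
    (contDiff_det hp.smooth ((contDiff_infty_iff_deriv (𝕜 := ℝ)).1 hγ.smooth).2).continuous
  have hsupport : Continuous fun θ => support p γ θ * wt p θ :=
    (hγ.contDiff_support hp).continuous.mul hp.contDiff_wt.continuous
  have hint := intervalIntegral.integral_eq_sub_of_hasDerivAt (a := 0) (b := 2 * π)
    (fun θ _ => hder θ) ((hlength.sub hsupport).intervalIntegrable _ _)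
  have hclosed : det (p (2 * π)) (γ (2 * π)) = det (p 0) (γ 0) := by
    rw [(Function.Antiperiodic.periodic_two_mul hp.antiperiodic).eq, hγ.closed.eq]
  rw [hclosed, sub_self, intervalIntegral.integral_sub (hlength.intervalIntegrable _ _)
    (hsupport.intervalIntegrable _ _)] at hint
  exact sub_eq_zero.1 hint

theorem support_mem_D0 (hp : IsUnitCircleParam N α p) (hγ : IsHedgehog p γ)
    (h0 : dualLength p γ = 0) : support p γ ∈ D0 p := by
  have hsmooth := hγ.contDiff_support hp
  refine ⟨⟨hsmooth.continuous, fun θ => ?_, hγ.dualLength_eq hp ▸ h0⟩,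
    contDiff_infty.1 hsmooth 2⟩
  rw [support, hγ.closed, hp.dual_antiperiodic.periodic_two_mul, support]

end IsHedgehog

theorem curveOf_add (p : ℝ → ℝ × ℝ) (hf : Differentiable ℝ f) (hg : Differentiable ℝ g) :
    curveOf p (f + g) = curveOf p f + curveOf p g := by
  funext θ
  simp only [curveOf, deriv_add (hf θ) (hg θ), Pi.add_apply]
  module

theorem curveOf_smul (p : ℝ → ℝ × ℝ) (a : ℝ) (hg : Differentiable ℝ g) :
    curveOf p (a • g) = a • curveOf p g := by
  funext θ
  simp only [curveOf, deriv_const_smul a (hg θ), Pi.smul_apply, smul_eq_mul]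
  module

theorem exists_norm_curveOf_le (hp : IsUnitCircleParam N α p) :
    ∃ C, 0 ≤ C ∧ ∀ g θ, ‖curveOf p g θ‖ ≤ C * (|g θ| + |deriv g θ / dualWt p θ|) := by
  obtain ⟨C, hC⟩ := ((Function.Antiperiodic.periodic_two_mul hp.antiperiodic)
    |>.isBounded_of_continuous two_pi_pos.ne' hp.smooth.continuous).exists_norm_le
  obtain ⟨D, hD⟩ := (hp.dual_antiperiodic.periodic_two_mul.isBounded_of_continuous
    two_pi_pos.ne' hp.contDiff_dual.continuous).exists_norm_le
  have hCp : ∀ θ, ‖p θ‖ ≤ C := fun θ => hC _ (mem_range_self θ)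
  have hDq : ∀ θ, ‖dual p θ‖ ≤ D := fun θ => hD _ (mem_range_self θ)
  refine ⟨max C D, ((norm_nonneg _).trans (hCp 0)).trans (le_max_left _ _), fun g θ => ?_⟩
  calc ‖curveOf p g θ‖ ≤ |g θ| * ‖p θ‖ + |deriv g θ / dualWt p θ| * ‖dual p θ‖ :=
        (norm_add_le _ _).trans_eq (by simp only [norm_smul, Real.norm_eq_abs])
    _ ≤ |g θ| * max C D + |deriv g θ / dualWt p θ| * max C D := by
        gcongr
        · exact (hCp θ).trans (le_max_left _ _)
        · exact (hDq θ).trans (le_max_right _ _)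
    _ = max C D * (|g θ| + |deriv g θ / dualWt p θ|) := by ring

end Curves

/-! ### Iterated involutes -/

section Iteration

open MeanZeroSpace

theorem tendstoUniformly_apply_of_norm_le {ι X E V : Type*} [SeminormedAddCommGroup E]
    [NormedSpace ℝ E] [SeminormedAddCommGroup V] [NormedSpace ℝ V] {Φ : E →ₗ[ℝ] X → V} {C : ℝ}
    (hΦ : ∀ x θ, ‖Φ x θ‖ ≤ C * ‖x‖) {l : Filter ι} {a : ι → E} {y : E} (ha : Tendsto a l (𝓝 y)) :
    TendstoUniformly (fun n => Φ (a n)) (Φ y) l := by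
  rw [Metric.tendstoUniformly_iff]
  intro ε hε
  have hlim : Tendsto (fun n => C * ‖y - a n‖) l (𝓝 0) := by
    simpa only [sub_self, norm_zero, mul_zero] using (ha.const_sub y).norm.const_mul C
  filter_upwards [hlim.eventually_lt_const hε] with n hn θ
  rw [dist_eq_norm, ← Pi.sub_apply, ← map_sub]
  exact (hΦ _ θ).trans_lt hn

theorem tendstoUniformly_of_succ {X V : Type*} [UniformSpace V] {F : ℕ → X → V} {f : X → V}
    (h : TendstoUniformly (fun n => F (n + 1)) f atTop) : TendstoUniformly F f atTop := by
  intro U hU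
  rw [← map_add_atTop_eq_nat 1]
  exact h U hU

variable {N : Seminorm ℝ (ℝ × ℝ)} {α lam mu : ℝ} {p : ℝ → ℝ × ℝ} {h u v : ℝ → ℝ} {j k : ℕ}

namespace IsUnitCircleParam

theorem differentiable_involute {hp : IsUnitCircleParam N α p} (x : hp.L0Space) :
    Differentiable ℝ (toFun (hp.involute x)) :=
  fun θ => (x.isSturmSolution_solutionMap.hasDerivAt θ).differentiableAt

/-- The curve with support function `S x`, as a linear function of `x` in `L₀`. -/
def involuteCurve (hp : IsUnitCircleParam N α p) : hp.L0Space →ₗ[ℝ] ℝ → ℝ × ℝ where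
  toFun x := curveOf p (MeanZeroSpace.toFun (hp.involute x))
  map_add' x y := by
    rw [map_add, map_add, curveOf_add p (differentiable_involute x) (differentiable_involute y)]
  map_smul' a x := by
    rw [map_smul, map_smul, curveOf_smul p a (differentiable_involute x), RingHom.id_apply]

theorem involuteCurve_apply {hp : IsUnitCircleParam N α p} (x : hp.L0Space) :
    hp.involuteCurve x = curveOf p (toFun (hp.involute x)) := rfl

theorem exists_norm_involuteCurve_le (hp : IsUnitCircleParam N α p) :
    ∃ C, ∀ x θ, ‖hp.involuteCurve x θ‖ ≤ C * ‖x‖ := by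
  obtain ⟨C, hC0, hC⟩ := exists_norm_curveOf_le hp
  obtain ⟨D, -, hD⟩ := exists_abs_solutionMap_le hp.periodicWeights.two_mul
  obtain ⟨E, -, hE⟩ := exists_abs_flux_solutionMap_le hp.periodicWeights.two_mul
  refine ⟨C * (D + E), fun x θ => (hC _ θ).trans ?_⟩
  rw [mul_assoc, add_mul]
  exact mul_le_mul_of_nonneg_left (add_le_add (hD x θ) (hE x θ)) hC0

theorem involute_smul_pow {hp : IsUnitCircleParam N α p} (x : hp.L0Space) (n : ℕ) :
    hp.involute (lam • lam ^ n • (hp.involute ^ n) x) =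
      lam ^ (n + 1) • (hp.involute ^ (n + 1)) x := by
  rw [smul_smul, ← pow_succ', map_smul, pow_succ' hp.involute, mul_apply_eq_comp]

-- One application of `S` upgrades convergence in the norm of `L₀` to uniform convergence.
theorem tendstoUniformly_pow_smul_S {hp : IsUnitCircleParam N α p} {x y : hp.L0Space}
    (hy : hp.involute (lam • y) = y)
    (hlim : Tendsto (fun n : ℕ => lam ^ n • (hp.involute ^ n) x) atTop (𝓝 y)) :
    TendstoUniformly (fun n : ℕ => lam ^ n • (S p)^[n] (toFun x)) (toFun y) atTop := by
  obtain ⟨C, -, hC⟩ := exists_abs_solutionMap_le hp.periodicWeights.two_mul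
  have hunif := tendstoUniformly_apply_of_norm_le
    (Φ := toFun ∘ₗ (hp.involute : hp.L0Space →ₗ[ℝ] hp.L0Space)) hC (hlim.const_smul lam)
  simp only [LinearMap.comp_apply, ContinuousLinearMap.coe_coe, involute_smul_pow, hy] at hunif
  exact tendstoUniformly_of_succ (by simpa only [map_smul, toFun_involute_pow] using hunif)

theorem tendstoUniformly_pow_smul_curveOf_S {hp : IsUnitCircleParam N α p} {x y : hp.L0Space}
    (hy : hp.involute (lam • y) = y)
    (hlim : Tendsto (fun n : ℕ => lam ^ n • (hp.involute ^ n) x) atTop (𝓝 y)) :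
    TendstoUniformly (fun n : ℕ => lam ^ n • curveOf p ((S p)^[n] (toFun x)))
      (curveOf p (toFun y)) atTop := by
  obtain ⟨C, hC⟩ := hp.exists_norm_involuteCurve_le
  have hsucc : ∀ n : ℕ, hp.involuteCurve (lam • lam ^ n • (hp.involute ^ n) x) =
      lam ^ (n + 1) • curveOf p ((S p)^[n + 1] (toFun x)) := fun n => by
    rw [smul_smul, ← pow_succ', map_smul, involuteCurve_apply, ← mul_apply_eq_comp, ← pow_succ',
      toFun_involute_pow]
  refine tendstoUniformly_of_succ ?_
  simpa only [hsucc, involuteCurve_apply (lam • y), hy] using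
    tendstoUniformly_apply_of_norm_le hC (hlim.const_smul lam)

theorem tendstoUniformly_iterate_S (hp : IsUnitCircleParam N α p) (hh : h ∈ C0 p) :
    TendstoUniformly (fun n : ℕ => (S p)^[n] h) 0 atTop ∧
      TendstoUniformly (fun n : ℕ => curveOf p ((S p)^[n] h)) 0 atTop := by
  obtain ⟨x, rfl⟩ := exists_toFun_eq (hW := hp.periodicWeights.two_mul) hh.1
  have hball : Ioo (0 : ℝ) 1 ⊆ Metric.ball 0 ‖(1 : ℝ)‖ := fun κ hκ =>
    mem_ball_zero_iff.2 (by rw [norm_one, Real.norm_of_nonneg hκ.1.le]; exact hκ.2)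
  have hlim := tendsto_inv_pow_smul_pow_apply isSymmetric_solutionMap one_ne_zero
    (closure_mono (spectralSpan_mono hball) ((toFun_mem_C0_iff (hp := hp)).1 hh))
  rw [inv_one] at hlim
  have hzero : hp.involute ((1 : ℝ) • 0) = 0 := by rw [smul_zero, map_zero]
  have hcurve : curveOf p 0 = 0 := by
    simpa only [zero_smul] using curveOf_smul p 0 (differentiable_const (0 : ℝ))
  have hS := tendstoUniformly_pow_smul_S hzero hlim
  have hC := tendstoUniformly_pow_smul_curveOf_S hzero hlim
  simp only [one_pow, one_smul, map_zero, hcurve] at hS hC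
  exact ⟨hS, hC⟩

end IsUnitCircleParam

namespace IsMode

theorem index_le_index (hp : IsUnitCircleParam N α p) (hu : IsMode p k lam u)
    (hv : IsMode p j mu v) (hle : lam ≤ mu) : k ≤ j := by
  have hcount := (hu.isSturmSolution hp).zeroCount_le hp.periodicWeights.two_mul hu.periodic
    (hv.isSturmSolution hp) hv.periodic hle hu.ne_zero
  rw [hu.zeroCount_eq, hv.zeroCount_eq] at hcount
  have htwo : 2 * k ≤ 2 * j := by exact_mod_cast hcount
  omega

theorem ne_zero_of_ip_ne_zero (hp : IsUnitCircleParam N α p) (hh : h ∈ L0 p)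
    (hv : IsMode p j mu v) (hne : ip p h v ≠ 0) : mu ≠ 0 := by
  rintro rfl
  have hconst : ∀ θ, v θ = v 0 := (hv.isSturmSolution hp).eq_const_of_eigenvalue_zero
    hp.periodicWeights.two_mul hv.periodic
  refine hne ?_
  simp only [ip, hconst, mul_right_comm _ (v 0)]
  rw [intervalIntegral.integral_mul_const, hh.2.2, zero_mul]

theorem inv_mem_spectralSupport {hp : IsUnitCircleParam N α p} {x : hp.L0Space}
    (hv : IsMode p j mu v) (hne : ip p (toFun x) v ≠ 0) :
    mu⁻¹ ∈ spectralSupport (hp.involute : Module.End ℝ hp.L0Space) x := by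
  obtain ⟨y, rfl, hy⟩ :=
    hv.exists_involute_eq hp (hv.ne_zero_of_ip_ne_zero hp x.toFun_mem hne)
  exact ⟨y, hy, hne⟩

theorem isDoubleEvolute_smul (hp : IsUnitCircleParam N α p) (hu : IsMode p k lam u) :
    IsDoubleEvolute p (curveOf p u) (lam • curveOf p u) := by
  have hdiff : Differentiable ℝ u := hu.contDiff.differentiable (by norm_num)
  rw [← curveOf_smul p lam hdiff]
  exact (hu.isSturmSolution hp).isDoubleEvolute hp (hdiff.const_smul lam)

end IsMode

theorem IsUnitCircleParam.exists_lowest_mode (hp : IsUnitCircleParam N α p) (hh : h ∈ C0 p)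
    (h0 : h ≠ 0) :
    ∃ (k : ℕ) (lam : ℝ) (u : ℝ → ℝ), 2 ≤ k ∧ IsMode p k lam u ∧
      (∀ (j : ℕ) (v : ℝ → ℝ), IsMode p j lam v → ip p (h - u) v = 0) ∧
      (∀ (j : ℕ) (mu : ℝ) (v : ℝ → ℝ), IsMode p j mu v → ip p h v ≠ 0 → k ≤ j ∧ lam ≤ mu) ∧
      TendstoUniformly (fun n : ℕ => lam ^ n • (S p)^[n] h) u atTop ∧
      TendstoUniformly (fun n : ℕ => lam ^ n • curveOf p ((S p)^[n] h)) (curveOf p u) atTop := by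
  obtain ⟨x, rfl⟩ := exists_toFun_eq (hW := hp.periodicWeights.two_mul) hh.1
  have hx := (toFun_mem_C0_iff (hp := hp)).1 hh
  have hx0 : x ≠ 0 := fun hx0 => h0 (by rw [hx0, map_zero])
  obtain ⟨κ, y, hκ, hy0, hy, hproj, hlim⟩ := exists_dominant_eigenvector
    (isCompactOperator_solutionMap _) isSymmetric_solutionMap (fun _ hκ => hκ.1) hx0 hx
  have hsupport := spectralSupport_subset isSymmetric_solutionMap hx
  have hκ01 : κ ∈ Ioo 0 1 := hsupport hκ.1
  obtain ⟨k, hk, hmode⟩ := exists_isMode_toFun hy0 hκ01.1.ne' hκ01.2.ne hy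
  have hfix : hp.involute (κ⁻¹ • y) = y := by
    rw [map_smul, hy, inv_smul_smul₀ hκ01.1.ne']
  refine ⟨k, κ⁻¹, toFun y, hk, hmode, fun j v hv => ?_, fun j mu v hv hne => ?_,
    tendstoUniformly_pow_smul_S hfix hlim, tendstoUniformly_pow_smul_curveOf_S hfix hlim⟩
  · obtain ⟨v, rfl, hvκ⟩ := hv.exists_involute_eq hp (inv_ne_zero hκ01.1.ne')
    rw [inv_inv] at hvκ
    rw [← map_sub]
    exact hproj v hvκ
  · have hmem := hv.inv_mem_spectralSupport (hp := hp) hne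
    have hle : κ⁻¹ ≤ mu := inv_le_of_inv_le₀ (inv_pos.1 (hsupport hmem).1) (hκ.2 hmem)
    exact ⟨hmode.index_le_index hp hv hle, hle⟩

end Iteration

end NormedPlane

end

theorem mainTheorem10 (N : Seminorm ℝ (ℝ × ℝ)) (α : ℝ) (p : ℝ → ℝ × ℝ)
    (hp : NormedPlane.IsUnitCircleParam N α p) :
    -- `S` is the inverse of `T`, and it is the involute operator on support functions
    BijOn (NormedPlane.T p) (NormedPlane.D0 p) (NormedPlane.L0 p) ∧
    (∀ h ∈ NormedPlane.L0 p, ContDiff ℝ 1 h →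
      NormedPlane.IsDoubleEvolute p
        (NormedPlane.curveOf p (NormedPlane.S p h)) (NormedPlane.curveOf p h)) ∧
    -- a closed curve is determined by its support function, which lies in `C₀` after a unique
    -- translation if the dual length is zero
    (∀ γ : ℝ → ℝ × ℝ, NormedPlane.IsHedgehog p γ →
      NormedPlane.curveOf p (NormedPlane.support p γ) = γ ∧
      (NormedPlane.dualLength p γ = 0 →
        ∃! v : ℝ × ℝ, NormedPlane.support p (fun θ => γ θ - v) ∈ NormedPlane.C0 p)) ∧
    -- the relevant eigenvalues exceed one
    (∀ (k : ℕ) (lam : ℝ) (u : ℝ → ℝ), 2 ≤ k → NormedPlane.IsMode p k lam u → 1 < lam) ∧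
    -- the iterated involutes converge to zero
    (∀ h ∈ NormedPlane.C0 p,
      TendstoUniformly (fun n : ℕ => (NormedPlane.S p)^[n] h) 0 atTop ∧
      TendstoUniformly (fun n : ℕ => NormedPlane.curveOf p ((NormedPlane.S p)^[n] h)) 0 atTop) ∧
    -- after rescaling they converge to the cycloid of the lowest nonzero mode
    (∀ h ∈ NormedPlane.C0 p, h ≠ 0 →
      ∃ (k : ℕ) (lam : ℝ) (u : ℝ → ℝ), 2 ≤ k ∧ NormedPlane.IsMode p k lam u ∧
        (∀ (j : ℕ) (v : ℝ → ℝ), NormedPlane.IsMode p j lam v → NormedPlane.ip p (h - u) v = 0) ∧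
        (∀ (j : ℕ) (mu : ℝ) (v : ℝ → ℝ), NormedPlane.IsMode p j mu v →
          NormedPlane.ip p h v ≠ 0 → k ≤ j ∧ lam ≤ mu) ∧
        NormedPlane.IsDoubleEvolute p
          (NormedPlane.curveOf p u) (lam • NormedPlane.curveOf p u) ∧
        TendstoUniformly (fun n : ℕ => lam ^ n • (NormedPlane.S p)^[n] h) u atTop ∧
        TendstoUniformly
          (fun n : ℕ => lam ^ n • NormedPlane.curveOf p ((NormedPlane.S p)^[n] h))
          (NormedPlane.curveOf p u) atTop) := by
  refine ⟨hp.bijOn_T,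
    fun h hh hd => (hp.isSturmSolution_S hh).isDoubleEvolute hp (hd.differentiable one_ne_zero),
    fun γ hγ => ⟨hγ.curveOf_support hp, fun h0 => ?_⟩, fun k lam u hk hu => hu.one_lt hp hk,
    fun h hh => hp.tendstoUniformly_iterate_S hh, fun h hh h0 => ?_⟩
  · have hsub : ∀ v, NormedPlane.support p (fun θ => γ θ - v) =
        fun θ => NormedPlane.support p γ θ - NormedPlane.det v (NormedPlane.dual p θ) :=
      fun v => funext fun θ => NormedPlane.det_sub_left _ _ _
    simpa only [hsub] using hp.existsUnique_sub_det_dual_mem_C0 (hγ.support_mem_D0 hp h0)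
  · obtain ⟨k, lam, u, hk, hu, hproj, hmin, hS, hcurve⟩ := hp.exists_lowest_mode hh h0
    exact ⟨k, lam, u, hk, hu, hproj, hmin, hu.isDoubleEvolute_smul hp, hS, hcurve⟩
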